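/- Let $\gamma=(1+\sqrt5)/2$. For a prime $p$, $\xi_p\in\mathbb{Q}_p$ and ${\bf x}=(x_0,x_1,x_2)\in\mathbb{Z}^3$, put $\|{\bf x}\|_\infty=\max_l|x_l|_\infty$ and $L_p({\bf x})=\max_{0\le l\le 2}|x_l-x_0\xi_p^l|_p$. A real number $\lambda_p$ is an exponent of approximation to $\xi_p$ in degree $2$ if there is a constant $c>0$ such that for every real $X\ge1$ there is a non-zero ${\bf x}\in\mathbb{Z}^3$ with $\|{\bf x}\|_\infty\le X$ and $L_p({\bf x})\le cX^{-\lambda_p}$. Identify ${\bf x}\in\mathbb{Z}^3$ with the symmetric matrix $\begin{pmatrix}x_0&x_1\\x_1&x_2\end{pmatrix}$, so that $\det({\bf x})=x_0x_2-x_1^2$, and put $[{\bf x},{\bf y},{\bf z}]=-{\bf x}J{\bf z}J{\bf y}$ with $J=\begin{pmatrix}0&1\\-1&0\end{pmatrix}$. Denote by $\det({\bf x},{\bf y},{\bf z})$ the determinant of the $3\times3$ matrix with rows ${\bf x},{\bf y},{\bf z}\in\mathbb{Z}^3$. There is a real number $\lambda_{p,0}=1.615358873\ldots$, independent of $p$,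 such that the following holds for every prime $p$, every $\xi_p\in\mathbb{Q}_p$ with $[\mathbb{Q}(\xi_p):\mathbb{Q}]>2$ and every exponent of approximation $\lambda_p\in(\lambda_{p,0},\gamma]$ to $\xi_p$ in degree $2$. Put $\theta=(\lambda_p-1)/(2-\lambda_p)$. There exists an unbounded sequence $({\bf y}_k)_{k\ge1}$ of primitive points of $\mathbb{Z}^3$ such that, with $Y_k=\|{\bf y}_k\|_\infty$ and implied constants independent of $k$, for all $k\ge1$, $$Y_k^{\theta}\ll Y_{k+1}\ll Y_k^{1/(\theta-1)},\qquad Y_k^{-2}\ll L_p({\bf y}_k)\ll Y_k^{-(1+\theta^2/(\theta+1))},$$ $$1\le|\det({\bf y}_k)|_\infty|\det({\bf y}_k)|_p\ll Y_k^{1-\theta^2/(\theta+1)},$$ $$1\le|\det({\bf y}_k,{\bf y}_{k+1},{\bf y}_{k+2})|_\infty|\det({\bf y}_k,{\bf y}_{k+1},{\bf y}_{k+2})|_p\ll Y_k^{1/(\theta-1)^2-\theta^2}.$$ Moreover, for every such sequence: (i) for each sufficiently large $k\ge3$, the point ${\bf y}_{k+1}$ is a non-zero rational multiple of $[{\bf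 y}_k,{\bf y}_k,{\bf y}_{k-2}]$; (ii) there is a non-symmetric matrix $M\in\mathrm{Mat}_{2\times2}(\mathbb{Z})$ with $\det(M)\ne0$ such that for each sufficiently large $k\ge3$, the point ${\bf y}_{k+1}$ is a non-zero rational multiple of ${\bf y}_kM_k{\bf y}_{k-1}$, where $M_k=M$ if $k$ is even and $M_k={}^tM$ if $k$ is odd. -/

import Mathlib

/-- `L_p(x) = ‖x - x₀ (1, ξ, …, ξⁿ)‖_p`, the maximum over `0 ≤ l ≤ n` of `|x_l - x₀ ξ^l|_p`
(the norm on a finite product is the sup norm). -/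
noncomputable def padicL (p : ℕ) [Fact p.Prime] (ξ : ℚ_[p]) {n : ℕ} (x : Fin (n + 1) → ℤ) : ℝ :=
  ‖fun l : Fin (n + 1) => (x l : ℚ_[p]) - (x 0 : ℚ_[p]) * ξ ^ (l : ℕ)‖

/-- `lam` is an exponent of approximation in degree `n` to `ξ ∈ ℚ_p`: for some `c > 0`, the
inequalities `‖x‖_∞ ≤ X` and `L_p(x) ≤ c X^(-lam)` have a non-zero solution
`x ∈ ℤ^(n+1)` for every real `X ≥ 1`. -/
def IsApproxExponent (p : ℕ) [Fact p.Prime] (n : ℕ) (ξ : ℚ_[p]) (lam : ℝ) : Prop :=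
  ∃ c : ℝ, 0 < c ∧ ∀ X : ℝ, 1 ≤ X →
    ∃ x : Fin (n + 1) → ℤ, x ≠ 0 ∧ ‖x‖ ≤ X ∧ padicL p ξ x ≤ c * X ^ (-lam)

/-- An integer point is primitive if its coordinates have greatest common divisor `1`. -/
def IsPrimitivePoint (x : Fin 3 → ℤ) : Prop :=
  Finset.univ.gcd x = 1

/-- The symmetric matrix `(x₀ x₁; x₁ x₂)` identified with the point `x = (x₀, x₁, x₂)`. -/
def symMat {R : Type*} (x : Fin 3 → R) : Matrix (Fin 2) (Fin 2) R :=
  !![x 0, x 1; x 1, x 2]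

/-- The matrix `J = (0 1; -1 0)`. -/
def matJ (R : Type*) [CommRing R] : Matrix (Fin 2) (Fin 2) R :=
  !![0, 1; -1, 0]

/-- `[x, y, z] = - x J z J y`, where points are viewed as symmetric matrices. -/
def bracket {R : Type*} [CommRing R] (x y z : Fin 3 → R) : Matrix (Fin 2) (Fin 2) R :=
  -(symMat x * matJ R * symMat z * matJ R * symMat y)

/-- `|a|_∞ |a|_p` for an integer `a`. -/
noncomputable def absProd (p : ℕ) [Fact p.Prime] (a : ℤ) : ℝ :=
  |(a : ℝ)| * ‖(a : ℚ_[p])‖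

/-- `A` is a non-zero rational multiple of `B`, for integer matrices `A` and `B`. -/
def IsNonzeroRatMultiple (A B : Matrix (Fin 2) (Fin 2) ℤ) : Prop :=
  ∃ r : ℚ, r ≠ 0 ∧ A.map (Int.cast : ℤ → ℚ) = r • B.map (Int.cast : ℤ → ℚ)

/-- `θ = (lam - 1) / (2 - lam)`. -/
noncomputable def thetaOf (lam : ℝ) : ℝ := (lam - 1) / (2 - lam)

/-- `(y_k)_{k ≥ 1}` is an unbounded sequence of primitive points of `ℤ³` such that, with
`Y_k = ‖y_k‖_∞` and `θ = (lam - 1) / (2 - lam)`,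
* `Y_k^θ ≪ Y_{k+1} ≪ Y_k^(1/(θ-1))`,
* `Y_k^(-2) ≪ L_p(y_k) ≪ Y_k^(-(1+θ²/(θ+1)))`,
* `1 ≤ |det y_k|_∞ |det y_k|_p ≪ Y_k^(1-θ²/(θ+1))`,
* `1 ≤ |det(y_k, y_{k+1}, y_{k+2})|_∞ |det(y_k, y_{k+1}, y_{k+2})|_p ≪ Y_k^(1/(θ-1)²-θ²)`,

with implied constants independent of `k`. The value `y 0` plays no role. -/
structure IsApproxSequence (p : ℕ) [Fact p.Prime] (ξ : ℚ_[p]) (lam : ℝ)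
    (y : ℕ → Fin 3 → ℤ) : Prop where
  primitive : ∀ k, 1 ≤ k → IsPrimitivePoint (y k)
  unbounded : ∀ B : ℝ, ∃ k, 1 ≤ k ∧ B < ‖y k‖
  norm_lower : ∃ C : ℝ, 0 < C ∧ ∀ k, 1 ≤ k →
    ‖y k‖ ^ thetaOf lam ≤ C * ‖y (k + 1)‖
  norm_upper : ∃ C : ℝ, 0 < C ∧ ∀ k, 1 ≤ k →
    ‖y (k + 1)‖ ≤ C * ‖y k‖ ^ (1 / (thetaOf lam - 1))
  padicL_lower : ∃ C : ℝ, 0 < C ∧ ∀ k, 1 ≤ k →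
    ‖y k‖ ^ (-2 : ℝ) ≤ C * padicL p ξ (y k)
  padicL_upper : ∃ C : ℝ, 0 < C ∧ ∀ k, 1 ≤ k →
    padicL p ξ (y k) ≤ C * ‖y k‖ ^ (-(1 + thetaOf lam ^ 2 / (thetaOf lam + 1)))
  det_lower : ∀ k, 1 ≤ k → 1 ≤ absProd p (symMat (y k)).det
  det_upper : ∃ C : ℝ, 0 < C ∧ ∀ k, 1 ≤ k →
    absProd p (symMat (y k)).det ≤ C * ‖y k‖ ^ (1 - thetaOf lam ^ 2 / (thetaOf lam + 1))
  det3_lower : ∀ k, 1 ≤ k →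
    1 ≤ absProd p (Matrix.of ![y k, y (k + 1), y (k + 2)]).det
  det3_upper : ∃ C : ℝ, 0 < C ∧ ∀ k, 1 ≤ k →
    absProd p (Matrix.of ![y k, y (k + 1), y (k + 2)]).det ≤
      C * ‖y k‖ ^ (1 / (thetaOf lam - 1) ^ 2 - thetaOf lam ^ 2)

/-! The engine is a Liouville argument: a non-zero integer a satisfies |a|_∞|a|_p ≥ 1, so an integer
determinant whose two absolute values have product below 1 must vanish, and a non-vanishing one
constrains the sizes of its entries.

Existence. D(x) = ‖x‖ L_p(x) does not decrease when x is multiplied by a non-zero integer, so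
primitive points x_n minimal for D can be used; they satisfy D(x_n) ≪ ‖x_{n+1}‖^{-(λ-1)}
(`IsApproxExponent.exists_isMinimalSequence`). As ξ has degree above 2, infinitely many triples x_i,
x_{i+1}, x_{i+2} are independent, and y_k = x_{i+1} for the k-th such i. Independence of the triple
forces Y_{k+1} to be large. Conversely y_{k+1} lies on the intersection of two distinct planes
spanned by consecutive minimal points, which bounds it above (`norm_le_of_planes_meet`) once
det(y_k) ≠ 0 is known (`one_le_of_det_eq_zero`). `growth_bounds` extracts the exponents.

Recurrence. Let w = [y_k, y_k, y_{k+1}]. Its coordinates are p-adically small enough that, when θ ≥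
1.5998, the determinants of w with the pairs (y_{k-2}, y_{k-1}) and (y_{k-3}, y_{k-2}) vanish for
large k (`det_bracketPoint_eq_zero`). Those pairs span distinct planes meeting in the line of
y_{k-2}, so w ∼ y_{k-2}. Since y ↦ [x, x, y] is an involution up to the factor det(x)², this gives
y_{k+1} ∼ [y_k, y_k, y_{k-2}].

Matrix. Solve y_{K+1} ∼ y_K N y_{K-1} for N at one index K. Transposing this relation and
substituting it into the bracket recurrence propagates it, with N replaced by its transpose at each
step. A symmetric matrix would make three consecutive y_k dependent. -/

theorem one_le_absProd (p : ℕ) [hp : Fact p.Prime] {a : ℤ} (ha : a ≠ 0) : 1 ≤ absProd p a := by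
  have hp0 : (0 : ℝ) < p := by exact_mod_cast hp.out.pos
  have haQ : (a : ℚ_[p]) ≠ 0 := by exact_mod_cast ha
  rw [absProd, Padic.norm_eq_zpow_neg_valuation haQ, Padic.valuation_intCast, zpow_neg, zpow_natCast,
    ← div_eq_mul_inv, one_le_div (by positivity)]
  have h : ((p : ℤ) ^ padicValInt p a) ∣ a := padicValInt_dvd a
  have := Int.le_of_dvd (abs_pos.mpr ha) ((dvd_abs _ _).mpr h)
  exact_mod_cast this

/-! ### p-adic estimates for determinants and cross products -/

section Ultrametric

variable {p : ℕ} [hp : Fact p.Prime]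

theorem padic_norm_add_le {a b : ℚ_[p]} {r : ℝ} (ha : ‖a‖ ≤ r) (hb : ‖b‖ ≤ r) : ‖a + b‖ ≤ r :=
  (Padic.nonarchimedean a b).trans (max_le ha hb)

theorem padic_norm_sub_le {a b : ℚ_[p]} {r : ℝ} (ha : ‖a‖ ≤ r) (hb : ‖b‖ ≤ r) : ‖a - b‖ ≤ r := by
  rw [sub_eq_add_neg]
  exact padic_norm_add_le ha (by rwa [norm_neg])

theorem padic_norm_mul_le {a b : ℚ_[p]} {r s t : ℝ} (ha : ‖a‖ ≤ r) (hb : ‖b‖ ≤ s)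
    (h : r * s ≤ t) : ‖a * b‖ ≤ t :=
  (norm_mul_le_of_le ha hb).trans h

theorem padic_norm_two_le : ‖(2 : ℚ_[p])‖ ≤ 1 := by
  simpa using Padic.norm_int_le_one (p := p) 2

theorem padicL_nonneg (ξ : ℚ_[p]) (x : Fin 3 → ℤ) : 0 ≤ padicL p ξ x := norm_nonneg _

theorem padicL_le_iff (ξ : ℚ_[p]) (x : Fin 3 → ℤ) {r : ℝ} (hr : 0 ≤ r) :
    padicL p ξ x ≤ r ↔ ‖(x 1 : ℚ_[p]) - x 0 * ξ‖ ≤ r ∧ ‖(x 2 : ℚ_[p]) - x 0 * ξ ^ 2‖ ≤ r := by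
  rw [padicL, pi_norm_le_iff_of_nonneg hr]
  simp [Fin.forall_fin_succ, hr]

theorem norm_error_one_le (ξ : ℚ_[p]) (x : Fin 3 → ℤ) :
    ‖(x 1 : ℚ_[p]) - x 0 * ξ‖ ≤ padicL p ξ x :=
  ((padicL_le_iff ξ x (padicL_nonneg ξ x)).1 le_rfl).1

theorem norm_error_two_le (ξ : ℚ_[p]) (x : Fin 3 → ℤ) :
    ‖(x 2 : ℚ_[p]) - x 0 * ξ ^ 2‖ ≤ padicL p ξ x :=
  ((padicL_le_iff ξ x (padicL_nonneg ξ x)).1 le_rfl).2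

theorem norm_error_one_le_bound {ξ : ℚ_[p]} {B : ℝ} (hB : 1 ≤ B) (hξ : ‖ξ‖ ≤ B)
    (x : Fin 3 → ℤ) : ‖(x 1 : ℚ_[p]) - x 0 * ξ‖ ≤ B :=
  padic_norm_sub_le ((Padic.norm_int_le_one _).trans hB)
    (padic_norm_mul_le (Padic.norm_int_le_one _) hξ (by simp))

/-- The linear form `e₂ - 2 ξ e₁` in the approximation errors. -/
theorem norm_error_comb_le {ξ : ℚ_[p]} {B : ℝ} (hB : 1 ≤ B) (hξ : ‖ξ‖ ≤ B) (x : Fin 3 → ℤ) :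
    ‖((x 2 : ℚ_[p]) - x 0 * ξ ^ 2) - 2 * ξ * ((x 1 : ℚ_[p]) - x 0 * ξ)‖ ≤ B * padicL p ξ x := by
  have hL := padicL_nonneg ξ x
  refine padic_norm_sub_le ((norm_error_two_le ξ x).trans (by nlinarith)) ?_
  exact padic_norm_mul_le (padic_norm_mul_le padic_norm_two_le hξ (one_mul B).le)
    (norm_error_one_le ξ x) le_rfl

/-- The determinant vanishes at (1, ξ, ξ²), so it is of first order in the errors; its linear part
there is x₀(e₂ - 2ξe₁). -/
theorem norm_det_two_le {ξ : ℚ_[p]} {B : ℝ} (hB : 1 ≤ B) (hξ : ‖ξ‖ ≤ B) (x : Fin 3 → ℤ) :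
    ‖((x 0 * x 2 - x 1 ^ 2 : ℤ) : ℚ_[p])‖ ≤ B * padicL p ξ x := by
  have hL := padicL_nonneg ξ x
  have key : ((x 0 * x 2 - x 1 ^ 2 : ℤ) : ℚ_[p]) =
      x 0 * (((x 2 : ℚ_[p]) - x 0 * ξ ^ 2) - 2 * ξ * ((x 1 : ℚ_[p]) - x 0 * ξ))
        - ((x 1 : ℚ_[p]) - x 0 * ξ) * ((x 1 : ℚ_[p]) - x 0 * ξ) := by
    push_cast; ring
  rw [key]
  exact padic_norm_sub_le
    (padic_norm_mul_le (Padic.norm_int_le_one _) (norm_error_comb_le hB hξ x) (one_mul _).le)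
    (padic_norm_mul_le (norm_error_one_le_bound hB hξ x) (norm_error_one_le ξ x) le_rfl)

theorem norm_cross_le {ξ : ℚ_[p]} {B r : ℝ} (hB : 1 ≤ B) (hξ : ‖ξ‖ ≤ B) {x y : Fin 3 → ℤ}
    (hx : padicL p ξ x ≤ r) (hy : padicL p ξ y ≤ r) (l : Fin 3) :
    ‖((crossProduct x y l : ℤ) : ℚ_[p])‖ ≤ B ^ 2 * r := by
  have hr : 0 ≤ r := (padicL_nonneg ξ x).trans hx
  have hB2 : (1 : ℝ) ≤ B ^ 2 := one_le_pow₀ hB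
  have hξ2 : ‖ξ ^ 2‖ ≤ B ^ 2 := by
    rw [norm_pow]; exact pow_le_pow_left₀ (norm_nonneg _) hξ 2
  have e1 := (norm_error_one_le ξ x).trans hx
  have e2 := (norm_error_two_le ξ x).trans hx
  have f1 := (norm_error_one_le ξ y).trans hy
  have f2 := (norm_error_two_le ξ y).trans hy
  have i (a : ℤ) : ‖(a : ℚ_[p])‖ ≤ 1 := Padic.norm_int_le_one a
  have hBr : B * r ≤ B ^ 2 * r := mul_le_mul_of_nonneg_right (by nlinarith) hr
  have hrr : 1 * r ≤ B ^ 2 * r := mul_le_mul_of_nonneg_right hB2 hr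
  rw [cross_apply]
  fin_cases l
  · have key : ((x 1 * y 2 - x 2 * y 1 : ℤ) : ℚ_[p]) =
        x 1 * (y 2 - y 0 * ξ ^ 2) - x 2 * (y 1 - y 0 * ξ)
        + (y 0 * ξ ^ 2 * (x 1 - x 0 * ξ) - y 0 * ξ * (x 2 - x 0 * ξ ^ 2)) := by
      push_cast; ring
    simp only [Fin.zero_eta, Matrix.cons_val_zero, key]
    refine padic_norm_add_le (padic_norm_sub_le ?_ ?_) (padic_norm_sub_le ?_ ?_)
    · exact padic_norm_mul_le (i _) f2 hrr
    · exact padic_norm_mul_le (i _) f1 hrr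
    · exact padic_norm_mul_le (padic_norm_mul_le (i _) hξ2 (one_mul _).le) e1 le_rfl
    · exact padic_norm_mul_le (padic_norm_mul_le (i _) hξ (one_mul _).le) e2 hBr
  · have key : ((x 2 * y 0 - x 0 * y 2 : ℤ) : ℚ_[p]) =
        y 0 * (x 2 - x 0 * ξ ^ 2) - x 0 * (y 2 - y 0 * ξ ^ 2) := by
      push_cast; ring
    simp only [Fin.mk_one, Matrix.cons_val_one, Matrix.cons_val_zero, key]
    exact padic_norm_sub_le (padic_norm_mul_le (i _) e2 hrr) (padic_norm_mul_le (i _) f2 hrr)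
  · have key : ((x 0 * y 1 - x 1 * y 0 : ℤ) : ℚ_[p]) =
        x 0 * (y 1 - y 0 * ξ) - y 0 * (x 1 - x 0 * ξ) := by
      push_cast; ring
    simp only [Fin.reduceFinMk, Matrix.cons_val_two, Matrix.tail_cons, Matrix.head_cons, key]
    exact padic_norm_sub_le (padic_norm_mul_le (i _) f1 hrr) (padic_norm_mul_le (i _) e1 hrr)

/-- Column operations replace the last two columns by the approximation errors. The separate bound a
for |x₀|_p matters when x is a bracket, whose first coordinate is itself p-adically small. -/
theorem norm_det_three_le {ξ : ℚ_[p]} {x y z : Fin 3 → ℤ} {a r s t m : ℝ}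
    (ha : ‖(x 0 : ℚ_[p])‖ ≤ a)
    (hx : padicL p ξ x ≤ r) (hy : padicL p ξ y ≤ s) (hz : padicL p ξ z ≤ t)
    (h1 : a * (s * t) ≤ m) (h2 : r * t ≤ m) (h3 : r * s ≤ m) :
    ‖(((Matrix.of ![x, y, z]).det : ℤ) : ℚ_[p])‖ ≤ m := by
  have e1 := (norm_error_one_le ξ x).trans hx
  have e2 := (norm_error_two_le ξ x).trans hx
  have f1 := (norm_error_one_le ξ y).trans hy
  have f2 := (norm_error_two_le ξ y).trans hy
  have g1 := (norm_error_one_le ξ z).trans hz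
  have g2 := (norm_error_two_le ξ z).trans hz
  have i (a : ℤ) : ‖(a : ℚ_[p])‖ ≤ 1 := Padic.norm_int_le_one a
  have key : (((Matrix.of ![x, y, z]).det : ℤ) : ℚ_[p]) =
      x 0 * ((y 1 - y 0 * ξ) * (z 2 - z 0 * ξ ^ 2) - (y 2 - y 0 * ξ ^ 2) * (z 1 - z 0 * ξ))
      - y 0 * ((x 1 - x 0 * ξ) * (z 2 - z 0 * ξ ^ 2) - (x 2 - x 0 * ξ ^ 2) * (z 1 - z 0 * ξ))
      + z 0 * ((x 1 - x 0 * ξ) * (y 2 - y 0 * ξ ^ 2) - (x 2 - x 0 * ξ ^ 2) * (y 1 - y 0 * ξ)) := by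
    rw [Matrix.det_fin_three]
    simp
    ring
  rw [key]
  refine padic_norm_add_le (padic_norm_sub_le ?_ ?_) ?_
  · exact padic_norm_mul_le ha (padic_norm_sub_le (padic_norm_mul_le f1 g2 le_rfl)
      (padic_norm_mul_le f2 g1 le_rfl)) h1
  · exact padic_norm_mul_le (i _) (padic_norm_sub_le (padic_norm_mul_le e1 g2 h2)
      (padic_norm_mul_le e2 g1 h2)) (one_mul _).le
  · exact padic_norm_mul_le (i _) (padic_norm_sub_le (padic_norm_mul_le e1 f2 h3)
      (padic_norm_mul_le e2 f1 h3)) (one_mul _).le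

end Ultrametric

/-! ### Archimedean estimates -/

section Archimedean

theorem abs_coord_le_norm (x : Fin 3 → ℤ) (l : Fin 3) : |(x l : ℝ)| ≤ ‖x‖ := by
  have := norm_le_pi_norm x l
  rwa [Int.norm_eq_abs] at this

theorem norm_le_of_abs_coord_le {x : Fin 3 → ℤ} {r : ℝ} (hr : 0 ≤ r)
    (h : ∀ l, |(x l : ℝ)| ≤ r) : ‖x‖ ≤ r := by
  rw [pi_norm_le_iff_of_nonneg hr]
  intro l
  rw [Int.norm_eq_abs]; exact h l

theorem abs_det_two_le (x : Fin 3 → ℤ) : |((x 0 * x 2 - x 1 ^ 2 : ℤ) : ℝ)| ≤ 2 * ‖x‖ ^ 2 := by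
  have h0 := abs_coord_le_norm x 0
  have h1 := abs_coord_le_norm x 1
  have h2 := abs_coord_le_norm x 2
  push_cast
  refine (abs_sub _ _).trans ?_
  rw [abs_mul, abs_pow]
  have := mul_le_mul h0 h2 (abs_nonneg _) (norm_nonneg _)
  have := pow_le_pow_left₀ (abs_nonneg _) h1 2
  linarith

theorem norm_cross_le_two_mul (x y : Fin 3 → ℤ) : ‖crossProduct x y‖ ≤ 2 * (‖x‖ * ‖y‖) := by
  have h (a b c d : Fin 3) : |((x a * y b - x c * y d : ℤ) : ℝ)| ≤ 2 * (‖x‖ * ‖y‖) := by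
    push_cast
    refine (abs_sub _ _).trans ?_
    rw [abs_mul, abs_mul]
    have := mul_le_mul (abs_coord_le_norm x a) (abs_coord_le_norm y b) (abs_nonneg _)
      (norm_nonneg _)
    have := mul_le_mul (abs_coord_le_norm x c) (abs_coord_le_norm y d) (abs_nonneg _)
      (norm_nonneg _)
    linarith
  refine norm_le_of_abs_coord_le (by positivity) fun l => ?_
  rw [cross_apply]
  fin_cases l
  exacts [h 1 2 2 1, h 2 0 0 2, h 0 1 1 0]

theorem det_three_eq_cross (x y z : Fin 3 → ℤ) :
    (Matrix.of ![x, y, z]).det = crossProduct x y 0 * z 0 + crossProduct x y 1 * z 1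
      + crossProduct x y 2 * z 2 := by
  rw [Matrix.det_fin_three, cross_apply]
  simp
  ring

theorem abs_det_three_le (x y z : Fin 3 → ℤ) :
    |(((Matrix.of ![x, y, z]).det : ℤ) : ℝ)| ≤ 6 * (‖x‖ * ‖y‖ * ‖z‖) := by
  have h (l : Fin 3) : |(crossProduct x y l * z l : ℝ)| ≤ 2 * (‖x‖ * ‖y‖ * ‖z‖) := by
    rw [abs_mul, ← mul_assoc]
    exact mul_le_mul ((abs_coord_le_norm _ l).trans (norm_cross_le_two_mul x y))
      (abs_coord_le_norm z l) (abs_nonneg _) (by positivity)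
  rw [det_three_eq_cross]
  push_cast
  refine (abs_add_three _ _ _).trans ?_
  linarith [h 0, h 1, h 2]

end Archimedean

/-! ### The bracket [x, x, y] -/

/-- The point corresponding to the symmetric matrix `[x, x, y]`. -/
def bracketPoint (x y : Fin 3 → ℤ) : Fin 3 → ℤ :=
  (x 0 * y 2 - 2 * x 1 * y 1 + x 2 * y 0) • x - (x 0 * x 2 - x 1 ^ 2) • y

theorem bracket_self_left (x y : Fin 3 → ℤ) : bracket x x y = symMat (bracketPoint x y) := by
  ext i j
  fin_cases i <;> fin_cases j <;>
    simp [bracket, symMat, matJ, bracketPoint] <;> ring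

/-- This near-involution lets a relation [x, x, y] ∼ a be inverted to y ∼ [x, x, a]. -/
theorem bracketPoint_bracketPoint (x y : Fin 3 → ℤ) :
    bracketPoint x (bracketPoint x y) = (x 0 * x 2 - x 1 ^ 2) ^ 2 • y := by
  ext l
  simp [bracketPoint]
  ring

theorem bracketPoint_smul (x y : Fin 3 → ℤ) (n : ℤ) :
    bracketPoint x (n • y) = n • bracketPoint x y := by
  ext l
  simp [bracketPoint]
  ring

theorem det_symMat (x : Fin 3 → ℤ) : (symMat x).det = x 0 * x 2 - x 1 ^ 2 := by
  simp [symMat, Matrix.det_fin_two]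
  ring

theorem norm_bracketPoint_le (x y : Fin 3 → ℤ) :
    ‖bracketPoint x y‖ ≤ 6 * (‖x‖ ^ 2 * ‖y‖) := by
  have hx := abs_coord_le_norm x
  have hy := abs_coord_le_norm y
  have hxy (i j : Fin 3) : |(x i * y j : ℝ)| ≤ ‖x‖ * ‖y‖ := by
    rw [abs_mul]; exact mul_le_mul (hx i) (hy j) (abs_nonneg _) (norm_nonneg _)
  have hB : |(x 0 * y 2 - 2 * x 1 * y 1 + x 2 * y 0 : ℝ)| ≤ 4 * (‖x‖ * ‖y‖) := by
    have h0 := abs_le.1 (hxy 0 2)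
    have h1 := abs_le.1 (hxy 1 1)
    have h2 := abs_le.1 (hxy 2 0)
    rw [abs_le]; constructor <;> linarith [h0.1, h0.2, h1.1, h1.2, h2.1, h2.2]
  refine norm_le_of_abs_coord_le (by positivity) fun l => ?_
  have h1 := mul_le_mul hB (hx l) (abs_nonneg _) (by positivity)
  have h2 := mul_le_mul (abs_det_two_le x) (hy l) (abs_nonneg _) (by positivity)
  rw [← abs_mul] at h1 h2
  simp only [bracketPoint, Pi.sub_apply, Pi.smul_apply, smul_eq_mul]
  push_cast at h2 ⊢
  refine (abs_sub _ _).trans ?_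
  nlinarith

section

variable {p : ℕ} [hp : Fact p.Prime]

/-- The bracket is a combination of x and y whose coefficients, det(x) and its polarization at (x,
y), are already O(r); the errors of x and y supply the second factor r. -/
theorem padicL_bracketPoint_le {ξ : ℚ_[p]} {B r : ℝ} (hB : 1 ≤ B) (hξ : ‖ξ‖ ≤ B)
    {x y : Fin 3 → ℤ} (hx : padicL p ξ x ≤ r) (hy : padicL p ξ y ≤ r) :
    padicL p ξ (bracketPoint x y) ≤ B * r ^ 2 := by
  have hr : 0 ≤ r := (padicL_nonneg ξ x).trans hx
  have i (a : ℤ) : ‖(a : ℚ_[p])‖ ≤ 1 := Padic.norm_int_le_one a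
  have hpair : ‖((x 0 * y 2 - 2 * x 1 * y 1 + x 2 * y 0 : ℤ) : ℚ_[p])‖ ≤ B * r := by
    have key : ((x 0 * y 2 - 2 * x 1 * y 1 + x 2 * y 0 : ℤ) : ℚ_[p]) =
        x 0 * ((y 2 - y 0 * ξ ^ 2) - 2 * ξ * (y 1 - y 0 * ξ))
        + y 0 * ((x 2 - x 0 * ξ ^ 2) - 2 * ξ * (x 1 - x 0 * ξ))
        - 2 * ((x 1 - x 0 * ξ) * (y 1 - y 0 * ξ)) := by
      push_cast; ring
    rw [key]
    refine padic_norm_sub_le (padic_norm_add_le ?_ ?_) ?_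
    · exact padic_norm_mul_le (i _) (norm_error_comb_le hB hξ y)
        ((one_mul _).le.trans (by gcongr))
    · exact padic_norm_mul_le (i _) (norm_error_comb_le hB hξ x)
        ((one_mul _).le.trans (by gcongr))
    · exact padic_norm_mul_le padic_norm_two_le (padic_norm_mul_le
        (norm_error_one_le_bound hB hξ x) ((norm_error_one_le ξ y).trans hy) le_rfl)
        (one_mul _).le
  have hdet : ‖((x 0 * x 2 - x 1 ^ 2 : ℤ) : ℚ_[p])‖ ≤ B * r :=
    (norm_det_two_le hB hξ x).trans (by gcongr)
  have aux (u v : ℚ_[p]) (hu : ‖u‖ ≤ r) (hv : ‖v‖ ≤ r) :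
      ‖((x 0 * y 2 - 2 * x 1 * y 1 + x 2 * y 0 : ℤ) : ℚ_[p]) * u
        - ((x 0 * x 2 - x 1 ^ 2 : ℤ) : ℚ_[p]) * v‖ ≤ B * r ^ 2 :=
    padic_norm_sub_le (padic_norm_mul_le hpair hu (by rw [pow_two, mul_assoc]))
      (padic_norm_mul_le hdet hv (by rw [pow_two, mul_assoc]))
  refine (padicL_le_iff ξ _ (by positivity)).2 ⟨?_, ?_⟩
  · convert aux _ _ ((norm_error_one_le ξ x).trans hx) ((norm_error_one_le ξ y).trans hy) using 2
    simp [bracketPoint]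
    ring
  · convert aux _ _ ((norm_error_two_le ξ x).trans hx) ((norm_error_two_le ξ y).trans hy) using 2
    simp [bracketPoint]
    ring

/-- In the expansion in errors, every term either carries an error of y or is quadratic in the
errors of x. -/
theorem norm_bracketPoint_zero_le {ξ : ℚ_[p]} {B r s m : ℝ} (hB : 1 ≤ B) (hξ : ‖ξ‖ ≤ B)
    {x y : Fin 3 → ℤ} (hx : padicL p ξ x ≤ r) (hy : padicL p ξ y ≤ s)
    (hs : s ≤ m) (hr : r ^ 2 ≤ m) :
    ‖((bracketPoint x y 0 : ℤ) : ℚ_[p])‖ ≤ B * m := by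
  have hr0 : 0 ≤ r := (padicL_nonneg ξ x).trans hx
  have hs0 : 0 ≤ s := (padicL_nonneg ξ y).trans hy
  have i (a : ℤ) : ‖(a : ℚ_[p])‖ ≤ 1 := Padic.norm_int_le_one a
  have key : ((bracketPoint x y 0 : ℤ) : ℚ_[p]) =
      x 0 * (x 0 * ((y 2 - y 0 * ξ ^ 2) - 2 * ξ * (y 1 - y 0 * ξ)))
        - 2 * (x 0 * ((x 1 - x 0 * ξ) * (y 1 - y 0 * ξ)))
        + y 0 * ((x 1 - x 0 * ξ) * (x 1 - x 0 * ξ)) := by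
    simp [bracketPoint]
    ring
  have e1 := (norm_error_one_le ξ x).trans hx
  rw [key]
  refine padic_norm_add_le (padic_norm_sub_le ?_ ?_) ?_
  · refine padic_norm_mul_le (i _) (padic_norm_mul_le (i _) (norm_error_comb_le hB hξ y)
      (one_mul _).le) ((one_mul _).le.trans ?_)
    gcongr
    exact hy.trans hs
  · exact padic_norm_mul_le padic_norm_two_le (padic_norm_mul_le (i _) (padic_norm_mul_le
      (norm_error_one_le_bound hB hξ x) ((norm_error_one_le ξ y).trans (hy.trans hs)) le_rfl)
      (one_mul _).le) (one_mul _).le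
  · refine padic_norm_mul_le (i _) (padic_norm_mul_le e1 e1 le_rfl) ((one_mul _).le.trans ?_)
    nlinarith

theorem absProd_det_bracketPoint_le {ξ : ℚ_[p]} {B r s t t' m : ℝ} (hB : 1 ≤ B) (hξ : ‖ξ‖ ≤ B)
    {x y a b : Fin 3 → ℤ} (hx : padicL p ξ x ≤ r) (hy : padicL p ξ y ≤ s)
    (ha : padicL p ξ a ≤ t) (hb : padicL p ξ b ≤ t') (hsr : s ≤ r) (htt : t' ≤ t) (ht1 : t' ≤ 1)
    (h1 : s * t * t' ≤ m) (h2 : r ^ 2 * t ≤ m) :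
    absProd p (Matrix.of ![bracketPoint x y, a, b]).det ≤
      36 * B * (‖x‖ ^ 2 * ‖y‖ * ‖a‖ * ‖b‖ * m) := by
  have hr0 : 0 ≤ r := (padicL_nonneg ξ x).trans hx
  have hs0 : 0 ≤ s := (padicL_nonneg ξ y).trans hy
  have ht0 : 0 ≤ t := (padicL_nonneg ξ a).trans ha
  have ht'0 : 0 ≤ t' := (padicL_nonneg ξ b).trans hb
  have hm : 0 ≤ m := le_trans (by positivity) h1
  have hB0 : 0 ≤ B := by linarith
  have hinf : |(((Matrix.of ![bracketPoint x y, a, b]).det : ℤ) : ℝ)| ≤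
      6 * (6 * (‖x‖ ^ 2 * ‖y‖) * ‖a‖ * ‖b‖) := by
    refine (abs_det_three_le _ _ _).trans ?_
    gcongr
    exact norm_bracketPoint_le x y
  have hpad : ‖(((Matrix.of ![bracketPoint x y, a, b]).det : ℤ) : ℚ_[p])‖ ≤ B * m := by
    refine norm_det_three_le (norm_bracketPoint_zero_le hB hξ hx hy (le_max_left _ _)
      (le_max_right _ _)) (padicL_bracketPoint_le hB hξ hx (hy.trans hsr)) ha hb ?_ ?_ ?_
    · rw [mul_assoc]
      refine mul_le_mul_of_nonneg_left ?_ hB0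
      rw [max_mul_of_nonneg _ _ (by positivity)]
      refine max_le (by linarith) (le_trans ?_ h2)
      rw [← mul_assoc]
      exact mul_le_of_le_one_right (by positivity) ht1
    · rw [mul_assoc]
      refine mul_le_mul_of_nonneg_left (le_trans ?_ h2) hB0
      gcongr
    · rw [mul_assoc]
      exact mul_le_mul_of_nonneg_left h2 hB0
  calc absProd p (Matrix.of ![bracketPoint x y, a, b]).det
      ≤ 6 * (6 * (‖x‖ ^ 2 * ‖y‖) * ‖a‖ * ‖b‖) * (B * m) :=
        mul_le_mul hinf hpad (norm_nonneg _) (by positivity)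
    _ = _ := by ring

end

/-- Cramer's rule for a vector lying in both planes `⟨a, b⟩` and `⟨c, a⟩`. -/
theorem smul_eq_smul_of_det_eq_zero {w a b c : Fin 3 → ℤ}
    (h1 : (Matrix.of ![w, a, b]).det = 0) (h2 : (Matrix.of ![w, c, a]).det = 0) :
    (Matrix.of ![c, a, b]).det • w = (Matrix.of ![c, w, b]).det • a := by
  rw [Matrix.det_fin_three] at h1 h2
  ext l
  simp only [Pi.smul_apply, smul_eq_mul, Matrix.det_fin_three]
  simp at h1 h2 ⊢
  fin_cases l <;> simp
  · linear_combination c 0 * h1 + b 0 * h2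
  · linear_combination c 1 * h1 + b 1 * h2
  · linear_combination c 2 * h1 + b 2 * h2

/-! ### Proportionality and the matrix recurrence -/

theorem isNonzeroRatMultiple_of_smul_eq {A B : Matrix (Fin 2) (Fin 2) ℤ} {m n : ℤ} (hm : m ≠ 0)
    (hn : n ≠ 0) (h : m • A = n • B) : IsNonzeroRatMultiple A B := by
  have hm' : (m : ℚ) ≠ 0 := by exact_mod_cast hm
  have hn' : (n : ℚ) ≠ 0 := by exact_mod_cast hn
  refine ⟨n / m, div_ne_zero hn' hm', ?_⟩
  ext i j
  have hij : m * A i j = n * B i j := by simpa using congrFun (congrFun h i) j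
  have hij' : (m : ℚ) * A i j = n * B i j := by exact_mod_cast hij
  simp only [Matrix.map_apply, Matrix.smul_apply, smul_eq_mul]
  field_simp
  linarith

theorem IsNonzeroRatMultiple.exists_smul_eq {A B : Matrix (Fin 2) (Fin 2) ℤ}
    (h : IsNonzeroRatMultiple A B) : ∃ m n : ℤ, m ≠ 0 ∧ n ≠ 0 ∧ m • A = n • B := by
  obtain ⟨r, hr, h⟩ := h
  refine ⟨r.den, r.num, by exact_mod_cast r.den_ne_zero, Rat.num_ne_zero.2 hr, ?_⟩
  ext i j
  have hij : (A i j : ℚ) = r * B i j := by simpa using congrFun (congrFun h i) j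
  have hd : (r.den : ℚ) * r = r.num := by rw [mul_comm]; exact Rat.mul_den_eq_num r
  have : (r.den : ℚ) * A i j = r.num * B i j := by rw [hij, ← mul_assoc, hd]
  simp only [Matrix.smul_apply, smul_eq_mul]
  exact_mod_cast this

theorem symMat_smul (n : ℤ) (x : Fin 3 → ℤ) : symMat (n • x) = n • symMat x := by
  ext i j
  fin_cases i <;> fin_cases j <;> simp [symMat]

theorem transpose_symMat (x : Fin 3 → ℤ) : (symMat x).transpose = symMat x := by
  ext i j
  fin_cases i <;> fin_cases j <;> simp [symMat]

/-- The bracket [x, x, y] lies in the planes ⟨a, b⟩ and ⟨c, a⟩, which meet only in the line of a;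
applying y ↦ [x, x, y] once more recovers y. -/
theorem isNonzeroRatMultiple_bracket {x y a b c : Fin 3 → ℤ} (hy : y ≠ 0)
    (hx : (symMat x).det ≠ 0) (hcab : (Matrix.of ![c, a, b]).det ≠ 0)
    (h1 : (Matrix.of ![bracketPoint x y, a, b]).det = 0)
    (h2 : (Matrix.of ![bracketPoint x y, c, a]).det = 0) :
    IsNonzeroRatMultiple (symMat y) (bracket x x a) := by
  have h := congrArg (bracketPoint x) (smul_eq_smul_of_det_eq_zero h1 h2)
  rw [bracketPoint_smul, bracketPoint_smul, bracketPoint_bracketPoint, ← det_symMat, smul_smul] at h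
  rw [bracket_self_left]
  have hm : (Matrix.of ![c, a, b]).det * (symMat x).det ^ 2 ≠ 0 :=
    mul_ne_zero hcab (pow_ne_zero 2 hx)
  refine isNonzeroRatMultiple_of_smul_eq hm (n := (Matrix.of ![c, bracketPoint x y, b]).det) ?_
    (by rw [← symMat_smul, ← symMat_smul, h])
  intro h0
  rw [h0, zero_smul] at h
  exact (smul_ne_zero hm hy) h

/-- Since z is symmetric, the off-diagonal entries of yMx agree. For symmetric M their difference
pairs the entries of M with x × y up to signs, and z · (x × y) is proportional to that same pairing.
-/
theorem det_eq_zero_of_isSymm {x y z : Fin 3 → ℤ} {M : Matrix (Fin 2) (Fin 2) ℤ} (hM : M.IsSymm)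
    (h : IsNonzeroRatMultiple (symMat z) (symMat y * M * symMat x)) :
    (Matrix.of ![x, y, z]).det = 0 := by
  obtain ⟨m, n, hm, hn, h⟩ := h.exists_smul_eq
  have hM' : M 1 0 = M 0 1 := hM.apply 0 1
  have e (i j) := congrFun (congrFun h i) j
  have e00 := e 0 0
  have e01 := e 0 1
  have e10 := e 1 0
  have e11 := e 1 1
  simp only [Matrix.smul_apply, smul_eq_mul, Matrix.mul_apply, Fin.sum_univ_two, hM'] at e00 e01 e10 e11
  simp [symMat] at e00 e01 e10 e11
  have hs : n * (M 0 0 * (y 0 * x 1 - y 1 * x 0) + M 0 1 * (y 0 * x 2 - y 2 * x 0)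
      + M 1 1 * (y 1 * x 2 - y 2 * x 1)) = 0 := by
    linear_combination e10 - e01
  have hs' := (mul_eq_zero.1 hs).resolve_left hn
  have : m * (Matrix.of ![x, y, z]).det = 0 := by
    rw [Matrix.det_fin_three]
    simp [-mul_eq_zero]
    linear_combination (x 1 * y 2 - x 2 * y 1) * e00 + (x 2 * y 0 - x 0 * y 2) * e01
      + (x 0 * y 1 - x 1 * y 0) * e11 + n * (x 2 * y 0 - x 1 * y 1) * hs'
  exact (mul_eq_zero.1 this).resolve_left hm

theorem IsNonzeroRatMultiple.transpose {A B : Matrix (Fin 2) (Fin 2) ℤ}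
    (h : IsNonzeroRatMultiple A B) : IsNonzeroRatMultiple A.transpose B.transpose := by
  obtain ⟨m, n, hm, hn, h⟩ := h.exists_smul_eq
  refine isNonzeroRatMultiple_of_smul_eq hm hn ?_
  rw [← Matrix.transpose_smul, ← Matrix.transpose_smul, h]

/-- If `y ∼ x M w` and `z ∼ [y, y, w]` then `z ∼ y ᵗM x`. -/
theorem isNonzeroRatMultiple_mul_transpose_mul {w x y z : Fin 3 → ℤ}
    {M : Matrix (Fin 2) (Fin 2) ℤ} (hw : (symMat w).det ≠ 0)
    (h : IsNonzeroRatMultiple (symMat y) (symMat x * M * symMat w))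
    (h' : IsNonzeroRatMultiple (symMat z) (bracket y y w)) :
    IsNonzeroRatMultiple (symMat z) (symMat y * M.transpose * symMat x) := by
  have ht := h.transpose
  rw [transpose_symMat, Matrix.transpose_mul, Matrix.transpose_mul, transpose_symMat,
    transpose_symMat] at ht
  obtain ⟨a, b, ha, hb, ht⟩ := ht.exists_smul_eq
  obtain ⟨m, n, hm, hn, h'⟩ := h'.exists_smul_eq
  refine isNonzeroRatMultiple_of_smul_eq (mul_ne_zero ha hm)
    (mul_ne_zero (mul_ne_zero hn hb) hw) ?_
  calc (a * m) • symMat z = n • -(symMat y * matJ ℤ * symMat w * matJ ℤ * (a • symMat y)) := by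
        rw [mul_smul, h', bracket, Matrix.mul_smul, smul_neg, smul_neg, smul_neg, smul_comm]
    _ = (n * b) • -(symMat y * (matJ ℤ * symMat w * matJ ℤ * symMat w) * M.transpose * symMat x) := by
        rw [ht, Matrix.mul_smul, ← smul_neg, smul_smul]
        simp only [Matrix.mul_assoc]
    _ = _ := by
        -- JwJ is minus the adjugate of w, so w cancels from the product up to the scalar -det(w).
        have : matJ ℤ * symMat w * matJ ℤ * symMat w
            = -(symMat w).det • (1 : Matrix (Fin 2) (Fin 2) ℤ) := by
          ext i j
          fin_cases i <;> fin_cases j <;> simp [symMat, matJ, Matrix.det_fin_two] <;> ring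
        rw [this]
        simp only [Matrix.smul_mul, Matrix.mul_smul, Matrix.mul_one, smul_smul, ← neg_smul]
        ring_nf

/-- The recurrence `y_{k+1} ∼ [y_k, y_k, y_{k-2}]` yields a matrix `M` with
`y_{k+1} ∼ y_k M_k y_{k-1}`, where `M_k` alternates between `M` and its transpose. -/
theorem exists_matrix_of_bracket_recurrence {y : ℕ → Fin 3 → ℤ} {K : ℕ} (hK : 3 ≤ K)
    (hdet : ∀ k, 1 ≤ k → (symMat (y k)).det ≠ 0)
    (hdet3 : ∀ k, 1 ≤ k → (Matrix.of ![y k, y (k + 1), y (k + 2)]).det ≠ 0)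
    (h : ∀ k, K ≤ k →
      IsNonzeroRatMultiple (symMat (y (k + 1))) (bracket (y k) (y k) (y (k - 2)))) :
    ∃ M : Matrix (Fin 2) (Fin 2) ℤ, ¬ M.IsSymm ∧ M.det ≠ 0 ∧
      ∃ K : ℕ, 3 ≤ K ∧ ∀ k, K ≤ k →
        IsNonzeroRatMultiple (symMat (y (k + 1)))
          (symMat (y k) * (if Even k then M else M.transpose) * symMat (y (k - 1))) := by
  -- Adjugates replace inverses so that N is integral; M is N or its transpose, so that the parity
  -- convention holds at K.
  set N := (symMat (y K)).adjugate * symMat (y (K + 1)) * (symMat (y (K - 1))).adjugate with hN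
  set M := if Even K then N else N.transpose with hM
  have hMK : (if Even K then M else M.transpose) = N := by
    by_cases hK2 : Even K <;> simp [hM, hK2]
  have hrec : ∀ k, K ≤ k → IsNonzeroRatMultiple (symMat (y (k + 1)))
      (symMat (y k) * (if Even k then M else M.transpose) * symMat (y (k - 1))) := by
    intro k hk
    induction k, hk using Nat.le_induction with
    | base =>
      rw [hMK]
      refine isNonzeroRatMultiple_of_smul_eq (m := (symMat (y K)).det * (symMat (y (K - 1))).det)
        (mul_ne_zero (hdet K (by omega)) (hdet (K - 1) (by omega))) one_ne_zero ?_
      rw [one_smul, hN]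
      calc _ = ((symMat (y K)).det • (1 : Matrix (Fin 2) (Fin 2) ℤ)) * symMat (y (K + 1)) *
            ((symMat (y (K - 1))).det • (1 : Matrix (Fin 2) (Fin 2) ℤ)) := by
              simp only [Matrix.smul_mul, Matrix.mul_smul, Matrix.mul_one, Matrix.one_mul, smul_smul]
              rw [mul_comm]
        _ = _ := by
          rw [← Matrix.mul_adjugate, ← Matrix.adjugate_mul]
          simp only [Matrix.mul_assoc]
    | succ k hk ih =>
      have hwk := isNonzeroRatMultiple_mul_transpose_mul (hdet (k - 1) (by omega)) ih
        (by simpa [show k + 1 - 2 = k - 1 by omega] using h (k + 1) (by omega))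
      have : (if Even k then M else M.transpose).transpose
          = if Even (k + 1) then M else M.transpose := by
        by_cases hk2 : Even k <;> simp [hk2, Nat.even_add_one]
      rwa [this] at hwk
  have hsymm : ¬ M.IsSymm := by
    intro hs
    have h1 := hrec K le_rfl
    rw [show (if Even K then M else M.transpose) = M by rw [hs.eq, ite_self]] at h1
    have h2 := hdet3 (K - 1) (by omega)
    rw [show K - 1 + 1 = K by omega, show K - 1 + 2 = K + 1 by omega] at h2
    exact h2 (det_eq_zero_of_isSymm hs h1)
  refine ⟨M, hsymm, ?_, K, hK, hrec⟩
  have hNdet : N.det ≠ 0 := by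
    rw [hN, Matrix.det_mul, Matrix.det_mul, Matrix.det_adjugate, Matrix.det_adjugate]
    simpa using ⟨⟨hdet K (by omega), hdet (K + 1) (by omega)⟩, hdet (K - 1) (by omega)⟩
  rw [hM]
  split_ifs
  · exact hNdet
  · rwa [Matrix.det_transpose]

/-! ### The bracket recurrence for approximation sequences -/

open Real

theorem IsPrimitivePoint.ne_zero {x : Fin 3 → ℤ} (hx : IsPrimitivePoint x) : x ≠ 0 := by
  rintro rfl
  have : Finset.univ.gcd (0 : Fin 3 → ℤ) = 0 := Finset.gcd_eq_zero_iff.2 fun _ _ => rfl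
  rw [IsPrimitivePoint, this] at hx
  exact zero_ne_one hx

theorem one_le_norm_of_ne_zero {x : Fin 3 → ℤ} (hx : x ≠ 0) : 1 ≤ ‖x‖ := by
  obtain ⟨l, hl⟩ := Function.ne_iff.1 hx
  refine le_trans ?_ (abs_coord_le_norm x l)
  exact_mod_cast Int.one_le_abs hl

theorem log_le_of_le_mul_rpow {X Y C e : ℝ} (hX : 0 < X) (hY : 0 < Y) (hC : 0 < C)
    (h : X ≤ C * Y ^ e) : log X ≤ log C + e * log Y := by
  have := log_le_log hX h
  rwa [log_mul hC.ne' (rpow_pos_of_pos hY e).ne', log_rpow hY] at this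

theorem absProd_zero (p : ℕ) [Fact p.Prime] : absProd p 0 = 0 := by simp [absProd]

theorem ne_zero_of_one_le_absProd {p : ℕ} [Fact p.Prime] {a : ℤ} (h : 1 ≤ absProd p a) :
    a ≠ 0 := by
  rintro rfl
  rw [absProd_zero] at h
  linarith

/-- Sizes are passed to logarithms, making the criterion linear. The last two hypotheses say that
the two competing terms of `absProd_det_bracketPoint_le` are each below 1. -/
theorem det_bracketPoint_eq_zero {p : ℕ} [Fact p.Prime] {ξ : ℚ_[p]} {B c q e t u α β : ℝ}
    (hB : 1 ≤ B) (hξ : ‖ξ‖ ≤ B) (hq : 36 * B ≤ exp q) {x y a b : Fin 3 → ℤ}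
    (hx : ‖x‖ = exp t) (hy : ‖y‖ = exp u) (ha : ‖a‖ = exp α) (hb : ‖b‖ = exp β)
    (hLx : padicL p ξ x ≤ exp (c - (1 + e) * t)) (hLy : padicL p ξ y ≤ exp (c - (1 + e) * u))
    (hLa : padicL p ξ a ≤ exp (c - (1 + e) * α)) (hLb : padicL p ξ b ≤ exp (c - (1 + e) * β))
    (he : 0 ≤ 1 + e) (htu : t ≤ u) (hαβ : α ≤ β) (hβ : c ≤ (1 + e) * β)
    (h1 : 3 * c + q + 2 * t - e * u - e * α - e * β < 0)
    (h2 : 3 * c + q + u - 2 * e * t - e * α + β < 0) :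
    (Matrix.of ![bracketPoint x y, a, b]).det = 0 := by
  by_contra h0
  set m := max (exp (c - (1 + e) * u) * exp (c - (1 + e) * α) * exp (c - (1 + e) * β))
    (exp (c - (1 + e) * t) ^ 2 * exp (c - (1 + e) * α)) with hm
  have hle := absProd_det_bracketPoint_le (m := m) hB hξ hLx hLy hLa hLb
    (exp_le_exp.2 (by nlinarith)) (exp_le_exp.2 (by nlinarith))
    (exp_le_one_iff.2 (by linarith)) (le_max_left _ _) (le_max_right _ _)
  have hm0 : 0 ≤ m := le_trans (by positivity) (le_max_left _ _)
  have hlt : exp q * (‖x‖ ^ 2 * ‖y‖ * ‖a‖ * ‖b‖ * m) < 1 := by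
    rw [hx, hy, ha, hb, ← exp_nat_mul, ← exp_add, ← exp_add, ← exp_add, ← mul_assoc, ← exp_add, hm,
      mul_max_of_nonneg _ _ (exp_pos _).le, ← exp_nat_mul, ← exp_add, ← exp_add, ← exp_add,
      ← exp_add, ← exp_add]
    push_cast
    exact max_lt (exp_lt_one_iff.2 (by linarith)) (exp_lt_one_iff.2 (by linarith))
  have := one_le_absProd p h0
  have := mul_le_mul_of_nonneg_right hq (by positivity : 0 ≤ ‖x‖ ^ 2 * ‖y‖ * ‖a‖ * ‖b‖ * m)
  linarith

/-- A real sequence growing at least geometrically up to an additive constant, once unbounded,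
tends to infinity. -/
theorem eventually_le_of_geometric_growth {t : ℕ → ℝ} {ρ c : ℝ} (hρ : 1 < ρ)
    (h : ∀ k, 1 ≤ k → ρ * t k - c ≤ t (k + 1)) (hunb : ∀ T, ∃ k, 1 ≤ k ∧ T < t k) (T : ℝ) :
    ∃ K, 1 ≤ K ∧ ∀ k, K ≤ k → T ≤ t k := by
  -- Above c/(ρ - 1), the fixed point of s ↦ ρs - c, the sequence can no longer decrease.
  obtain ⟨K, hK1, hK⟩ := hunb (max T (c / (ρ - 1)))
  refine ⟨K, hK1, fun k hk => (le_max_left _ (c / (ρ - 1))).trans ?_⟩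
  induction k, hk using Nat.le_induction with
  | base => exact hK.le
  | succ k hk ih =>
    have h1 := h k (by omega)
    have h2 := (div_le_iff₀ (by linarith)).1 ((le_max_right T _).trans ih)
    linarith

theorem IsApproxSequence.eventually_bracket {p : ℕ} [Fact p.Prime] {ξ : ℚ_[p]} {lam : ℝ}
    {y : ℕ → Fin 3 → ℤ} (h : IsApproxSequence p ξ lam y) (hθ : 1.5998 ≤ thetaOf lam) :
    ∃ K : ℕ, 3 ≤ K ∧ ∀ k, K ≤ k →
      IsNonzeroRatMultiple (symMat (y (k + 1))) (bracket (y k) (y k) (y (k - 2))) := by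
  obtain ⟨C₁, hC₁, hlow⟩ := h.norm_lower
  obtain ⟨C₂, hC₂, hupp⟩ := h.norm_upper
  obtain ⟨C₃, hC₃, hL⟩ := h.padicL_upper
  set θ := thetaOf lam
  -- The decimals 0.984 and 1.6673 are rounded values of θ²/(θ+1) and 1/(θ-1) at θ = 1.5998, rounded
  -- in the safe direction.
  have hδ : 1 + 0.984 ≤ 1 + θ ^ 2 / (θ + 1) := by
    have : 0.984 ≤ θ ^ 2 / (θ + 1) := (le_div_iff₀ (by linarith)).2 (by nlinarith)
    linarith
  have hσ : 1 / (θ - 1) ≤ 1.6673 := by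
    rw [div_le_iff₀ (by linarith)]; linarith
  have hy1 : ∀ k, 1 ≤ k → 1 ≤ ‖y k‖ := fun k hk => one_le_norm_of_ne_zero (h.primitive k hk).ne_zero
  have hy0 : ∀ k, 1 ≤ k → 0 < ‖y k‖ := fun k hk => one_pos.trans_le (hy1 k hk)
  set t : ℕ → ℝ := fun k => log ‖y k‖ with ht
  have htpos : ∀ k, 1 ≤ k → 0 ≤ t k := fun k hk => log_nonneg (hy1 k hk)
  have hexp : ∀ k, 1 ≤ k → ‖y k‖ = exp (t k) := fun k hk => (exp_log (hy0 k hk)).symm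
  set c := |log C₁| + |log C₂| + |log C₃| with hc
  have hc₁ : log C₁ ≤ c := by
    linarith [le_abs_self (log C₁), abs_nonneg (log C₂), abs_nonneg (log C₃)]
  have hc₂ : log C₂ ≤ c := by
    linarith [le_abs_self (log C₂), abs_nonneg (log C₁), abs_nonneg (log C₃)]
  have hc₃ : log C₃ ≤ c := by
    linarith [le_abs_self (log C₃), abs_nonneg (log C₁), abs_nonneg (log C₂)]
  have hc0 : 0 ≤ c := by positivity
  have h1 : ∀ k, 1 ≤ k → 1.5998 * t k - c ≤ t (k + 1) := by
    intro k hk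
    have := log_le_log (rpow_pos_of_pos (hy0 k hk) _) (hlow k hk)
    rw [log_mul hC₁.ne' (hy0 (k + 1) (by omega)).ne', log_rpow (hy0 k hk)] at this
    have := mul_le_mul_of_nonneg_right hθ (htpos k hk)
    simp only [ht] at *
    linarith
  have h2 : ∀ k, 1 ≤ k → t (k + 1) ≤ 1.6673 * t k + c := by
    intro k hk
    have := log_le_of_le_mul_rpow (hy0 (k + 1) (by omega)) (hy0 k hk) hC₂ (hupp k hk)
    have := mul_le_mul_of_nonneg_right hσ (htpos k hk)
    simp only [ht] at *
    linarith
  have h3 : ∀ k, 1 ≤ k → padicL p ξ (y k) ≤ exp (c - (1 + 0.984) * t k) := by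
    intro k hk
    refine (hL k hk).trans ?_
    have := mul_le_mul_of_nonneg_right hδ (htpos k hk)
    rw [rpow_def_of_pos (hy0 k hk), ← exp_log hC₃, ← exp_add, exp_le_exp]
    simp only [ht] at *
    linarith
  set B := max 1 ‖ξ‖ with hB
  have hB1 : 1 ≤ B := le_max_left _ _
  set q := log (36 * B) with hq
  have hq' : 36 * B ≤ exp q := (exp_log (by positivity)).ge
  have hq0 : 0 ≤ q := log_nonneg (by linarith)
  have hunb : ∀ T, ∃ k, 1 ≤ k ∧ T < t k := by
    intro T
    obtain ⟨k, hk, hlt⟩ := h.unbounded (exp T)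
    exact ⟨k, hk, (lt_log_iff_exp_lt (hy0 k hk)).2 hlt⟩
  -- The factor 1000 is generous: it only has to let the negative leading terms absorb all additive
  -- constants.
  obtain ⟨K, hK1, hK⟩ := eventually_le_of_geometric_growth (by norm_num) h1 hunb
    (1000 * (c + q + 1))
  refine ⟨K + 4, by omega, fun k hk => ?_⟩
  -- The bracket of y_{n+3} with y_{n+4} is tested against y_n, y_{n+1}, y_{n+2}, which form an
  -- independent triple. The tightest inequality is t_{n+4} + t_{n+2} < 2(0.984)t_{n+3} + 0.984
  -- t_{n+1}, up to constants.
  obtain ⟨n, rfl⟩ : ∃ n, k = n + 3 := ⟨k - 3, by omega⟩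
  have e1 := h1 n (by omega)
  have e2 := h1 (n + 1) (by omega)
  have e3 := h1 (n + 2) (by omega)
  have e4 := h1 (n + 3) (by omega)
  have f1 := h2 n (by omega)
  have f2 := h2 (n + 1) (by omega)
  have f3 := h2 (n + 2) (by omega)
  have f4 := h2 (n + 3) (by omega)
  have g := hK n (by omega)
  simp only [add_assoc, Nat.reduceAdd] at e1 e2 e3 e4 f1 f2 f3 f4
  have hdet3 := h.det3_lower n (by omega)
  simp only [show n + 3 - 2 = n + 1 by omega, add_assoc, Nat.reduceAdd]
  refine isNonzeroRatMultiple_bracket (h.primitive _ (by omega)).ne_zero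
    (ne_zero_of_one_le_absProd (h.det_lower _ (by omega)))
    (ne_zero_of_one_le_absProd hdet3) ?_ ?_
  · refine det_bracketPoint_eq_zero hB1 (le_max_right _ _) hq' (hexp _ (by omega))
      (hexp _ (by omega)) (hexp _ (by omega)) (hexp _ (by omega)) (h3 _ (by omega))
      (h3 _ (by omega)) (h3 _ (by omega)) (h3 _ (by omega)) ?_ ?_ ?_ ?_ ?_ ?_ <;> linarith
  · refine det_bracketPoint_eq_zero hB1 (le_max_right _ _) hq' (hexp _ (by omega))
      (hexp _ (by omega)) (hexp _ (by omega)) (hexp _ (by omega)) (h3 _ (by omega))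
      (h3 _ (by omega)) (h3 _ (by omega)) (h3 _ (by omega)) ?_ ?_ ?_ ?_ ?_ ?_ <;> linarith

theorem IsApproxSequence.bracket_and_matrix {p : ℕ} [Fact p.Prime] {ξ : ℚ_[p]} {lam : ℝ}
    {y : ℕ → Fin 3 → ℤ} (h : IsApproxSequence p ξ lam y) (hθ : 1.5998 ≤ thetaOf lam) :
    (∃ K : ℕ, 3 ≤ K ∧ ∀ k, K ≤ k →
      IsNonzeroRatMultiple (symMat (y (k + 1))) (bracket (y k) (y k) (y (k - 2)))) ∧
    ∃ M : Matrix (Fin 2) (Fin 2) ℤ, ¬ M.IsSymm ∧ M.det ≠ 0 ∧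
      ∃ K : ℕ, 3 ≤ K ∧ ∀ k, K ≤ k →
        IsNonzeroRatMultiple (symMat (y (k + 1)))
          (symMat (y k) * (if Even k then M else M.transpose) * symMat (y (k - 1))) := by
  have hbr := h.eventually_bracket hθ
  refine ⟨hbr, ?_⟩
  obtain ⟨K, hK, hrec⟩ := hbr
  exact exists_matrix_of_bracket_recurrence hK
    (fun k hk => ne_zero_of_one_le_absProd (h.det_lower k hk))
    (fun k hk => ne_zero_of_one_le_absProd (h.det3_lower k hk)) hrec

/-! ### Minimal points for the projective distance -/

section

variable {p : ℕ} [hp : Fact p.Prime]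

/-- The projective distance `‖x‖_∞ L_p(x)`. -/
noncomputable def projDist (p : ℕ) [Fact p.Prime] (ξ : ℚ_[p]) (x : Fin 3 → ℤ) : ℝ :=
  ‖x‖ * padicL p ξ x

theorem projDist_nonneg (ξ : ℚ_[p]) (x : Fin 3 → ℤ) : 0 ≤ projDist p ξ x :=
  mul_nonneg (norm_nonneg _) (padicL_nonneg ξ x)

theorem padicL_smul (ξ : ℚ_[p]) (g : ℤ) (x : Fin 3 → ℤ) :
    padicL p ξ (g • x) = ‖(g : ℚ_[p])‖ * padicL p ξ x := by
  rw [padicL, padicL, ← norm_smul]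
  congr 1
  ext l
  simp
  ring

theorem projDist_smul (ξ : ℚ_[p]) (g : ℤ) (x : Fin 3 → ℤ) :
    projDist p ξ (g • x) = absProd p g * projDist p ξ x := by
  rw [projDist, projDist, absProd, padicL_smul, norm_smul, Int.norm_eq_abs]
  ring

theorem projDist_neg (ξ : ℚ_[p]) (x : Fin 3 → ℤ) : projDist p ξ (-x) = projDist p ξ x := by
  have := projDist_smul ξ (-1) x
  simpa [absProd] using this

/-- Dividing by the content g divides D by |g|_∞|g|_p ≥ 1. For L_p alone this can fail, hence the
passage to D, at the cost of one in the exponent. -/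
theorem IsApproxExponent.exists_primitive {ξ : ℚ_[p]} {lam : ℝ} (h : IsApproxExponent p 2 ξ lam) :
    ∃ c : ℝ, 0 < c ∧ ∀ X : ℝ, 1 ≤ X → ∃ x : Fin 3 → ℤ, IsPrimitivePoint x ∧ ‖x‖ ≤ X ∧
      projDist p ξ x ≤ c * X ^ (-(lam - 1)) := by
  obtain ⟨c, hc, h⟩ := h
  refine ⟨c, hc, fun X hX => ?_⟩
  obtain ⟨x, hx0, hxX, hxL⟩ := h X hX
  obtain ⟨z, hz, hz1⟩ := Finset.extract_gcd (s := Finset.univ) x Finset.univ_nonempty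
  set g := Finset.univ.gcd x
  have hxz : x = g • z := by
    ext l; simpa using hz l (Finset.mem_univ l)
  have hg : g ≠ 0 := by
    rintro h0; rw [h0, zero_smul] at hxz; exact hx0 hxz
  refine ⟨z, hz1, ?_, ?_⟩
  · refine le_trans ?_ hxX
    rw [hxz, norm_smul, Int.norm_eq_abs]
    exact le_mul_of_one_le_left (norm_nonneg _) (by exact_mod_cast Int.one_le_abs hg)
  · calc projDist p ξ z ≤ absProd p g * projDist p ξ z :=
          le_mul_of_one_le_left (projDist_nonneg ξ z) (one_le_absProd p hg)
      _ = projDist p ξ x := by rw [← projDist_smul, ← hxz]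
      _ ≤ X * (c * X ^ (-lam)) := mul_le_mul hxX hxL (padicL_nonneg ξ x) (by linarith)
      _ = c * X ^ (-(lam - 1)) := by
          rw [show -(lam - 1) = -lam + 1 by ring, rpow_add_one (by linarith)]
          ring

theorem int_relation_eq_zero {ξ : ℚ_[p]}
    (h : 2 < Module.rank ℚ (IntermediateField.adjoin ℚ {ξ})) {a b c : ℤ}
    (habc : (a : ℚ_[p]) + b * ξ + c * ξ ^ 2 = 0) : a = 0 ∧ b = 0 ∧ c = 0 := by
  by_contra hne
  open Polynomial in
  set P : ℚ[X] := C (a : ℚ) + C (b : ℚ) * X + C (c : ℚ) * X ^ 2 with hP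
  have hP0 : P ≠ 0 := by
    intro h0
    have h0' := congrArg (fun Q => (Q.coeff 0, Q.coeff 1, Q.coeff 2)) h0
    simp only [hP, Polynomial.coeff_add, Polynomial.coeff_C_mul, Polynomial.coeff_X_pow,
      Polynomial.coeff_X, Polynomial.coeff_C] at h0'
    simp at h0'
    exact hne h0'
  have hroot : Polynomial.aeval ξ P = 0 := by
    simpa [hP] using habc
  have hint : IsIntegral ℚ ξ := isAlgebraic_iff_isIntegral.1 ⟨P, hP0, hroot⟩
  have hdeg : P.natDegree ≤ 2 := by
    rw [hP]; compute_degree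
  have hmin : (minpoly ℚ ξ).natDegree ≤ 2 :=
    (Polynomial.natDegree_le_of_dvd (minpoly.dvd ℚ ξ hroot) hP0).trans hdeg
  have : FiniteDimensional ℚ (IntermediateField.adjoin ℚ {ξ}) :=
    IntermediateField.adjoin.finiteDimensional hint
  rw [← Module.finrank_eq_rank, IntermediateField.adjoin.finrank hint] at h
  have h' : 2 < (minpoly ℚ ξ).natDegree := by exact_mod_cast h
  omega

theorem projDist_pos {ξ : ℚ_[p]} (h : 2 < Module.rank ℚ (IntermediateField.adjoin ℚ {ξ}))
    {x : Fin 3 → ℤ} (hx : x ≠ 0) : 0 < projDist p ξ x := by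
  refine mul_pos (norm_pos_iff.2 hx) (lt_of_le_of_ne (padicL_nonneg ξ x) fun h0 => hx ?_)
  have h1 := norm_le_zero_iff.1 (h0 ▸ norm_error_one_le ξ x)
  have h2 := norm_le_zero_iff.1 (h0 ▸ norm_error_two_le ξ x)
  obtain ⟨e0, e1, -⟩ := int_relation_eq_zero h (a := x 1) (b := -x 0) (c := 0)
    (by push_cast; linear_combination h1)
  obtain ⟨e2, -, -⟩ := int_relation_eq_zero h (a := x 2) (b := 0) (c := -x 0)
    (by push_cast; linear_combination h2)
  ext l
  fin_cases l
  exacts [neg_eq_zero.1 e1, e0, e2]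

theorem finite_setOf_norm_le (R : ℝ) : {x : Fin 3 → ℤ | ‖x‖ ≤ R}.Finite := by
  have := (isCompact_closedBall (0 : Fin 3 → ℤ) R).finite_of_discrete
  refine this.subset fun x hx => ?_
  simpa using hx

theorem exists_minimal_primitive {ξ : ℚ_[p]} {d : ℝ}
    (h : ∃ x : Fin 3 → ℤ, IsPrimitivePoint x ∧ projDist p ξ x < d) :
    ∃ x : Fin 3 → ℤ, (IsPrimitivePoint x ∧ projDist p ξ x < d) ∧
      ∀ z : Fin 3 → ℤ, IsPrimitivePoint z → projDist p ξ z < d → ‖x‖ ≤ ‖z‖ := by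
  obtain ⟨x₀, hx₀⟩ := h
  obtain ⟨x, ⟨hx, hxx₀⟩, hmin⟩ := Set.exists_min_image
    ({x : Fin 3 → ℤ | IsPrimitivePoint x ∧ projDist p ξ x < d} ∩ {x | ‖x‖ ≤ ‖x₀‖})
    (fun x => ‖x‖) ((finite_setOf_norm_le ‖x₀‖).inter_of_right _) ⟨x₀, hx₀, le_refl ‖x₀‖⟩
  refine ⟨x, hx, fun z hz hzd => ?_⟩
  by_cases hzx : ‖z‖ ≤ ‖x₀‖
  · exact hmin z ⟨⟨hz, hzd⟩, hzx⟩
  · exact (show ‖x‖ ≤ ‖x₀‖ from hxx₀).trans (not_le.1 hzx).le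

/-- A sequence of primitive points of nondecreasing norm with the properties of a sequence of
minimal points for the projective distance. -/
structure IsMinimalSequence (p : ℕ) [Fact p.Prime] (ξ : ℚ_[p]) (μ c : ℝ)
    (x : ℕ → Fin 3 → ℤ) : Prop where
  primitive : ∀ n, IsPrimitivePoint (x n)
  monotone : Monotone fun n => ‖x n‖
  strictAnti : StrictAnti fun n => projDist p ξ (x n)
  upper : ∀ n, projDist p ξ (x n) ≤ c * ‖x (n + 1)‖ ^ (-μ)

theorem IsApproxExponent.exists_isMinimalSequence {ξ : ℚ_[p]} {lam : ℝ}
    (hξ : 2 < Module.rank ℚ (IntermediateField.adjoin ℚ {ξ})) (hlam : 1 < lam)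
    (h : IsApproxExponent p 2 ξ lam) :
    ∃ c : ℝ, 0 < c ∧ ∃ x : ℕ → Fin 3 → ℤ, IsMinimalSequence p ξ (lam - 1) c x := by
  obtain ⟨c, hc, h⟩ := h.exists_primitive
  have hμ : 0 < lam - 1 := by linarith
  have hex : ∀ d : ℝ, 0 < d → ∃ x : Fin 3 → ℤ, IsPrimitivePoint x ∧ projDist p ξ x < d := by
    intro d hd
    have ht : Filter.Tendsto (fun X : ℝ => c * X ^ (-(lam - 1))) Filter.atTop (nhds (c * 0)) :=
      (tendsto_rpow_neg_atTop hμ).const_mul c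
    rw [mul_zero] at ht
    obtain ⟨X, hXd, hX1⟩ :=
      ((ht.eventually_lt_const hd).and (Filter.eventually_ge_atTop 1)).exists
    obtain ⟨x, hx, -, hxX⟩ := h X hX1
    exact ⟨x, hx, hxX.trans_lt hXd⟩
  -- Each next point has least norm among primitive points with D below the current value; the
  -- initial threshold is 1.
  choose! f hf hfmin using fun d (hd : 0 < d) => exists_minimal_primitive (hex d hd)
  obtain ⟨x, hx0, hxs⟩ : ∃ x : ℕ → Fin 3 → ℤ, x 0 = f 1 ∧
      ∀ n, x (n + 1) = f (projDist p ξ (x n)) :=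
    ⟨fun n => Nat.rec (f 1) (fun _ z => f (projDist p ξ z)) n, rfl, fun _ => rfl⟩
  have hprim : ∀ n, IsPrimitivePoint (x n) := by
    intro n
    induction n with
    | zero => rw [hx0]; exact (hf 1 one_pos).1
    | succ n ih => rw [hxs]; exact (hf _ (projDist_pos hξ ih.ne_zero)).1
  have hpos : ∀ n, 0 < projDist p ξ (x n) := fun n => projDist_pos hξ (hprim n).ne_zero
  have hanti : StrictAnti fun n => projDist p ξ (x n) := by
    refine strictAnti_nat_of_succ_lt fun n => ?_
    rw [hxs]; exact (hf _ (hpos n)).2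
  have hlt1 : projDist p ξ (x 0) < 1 := by rw [hx0]; exact (hf 1 one_pos).2
  have hmono : Monotone fun n => ‖x n‖ := by
    refine monotone_nat_of_le_succ fun n => ?_
    cases n with
    | zero =>
      have := hfmin 1 one_pos _ (hprim 1) ((hanti (Nat.zero_lt_succ 0)).trans hlt1)
      rwa [← hx0] at this
    | succ n =>
      have := hfmin _ (hpos n) _ (hprim (n + 2)) (hanti (by omega))
      rwa [← hxs] at this
  -- At height ‖x_{n+1}‖/2 no primitive point beats D(x_n), by minimality. Halving makes the height
  -- strictly smaller, giving the factor 2^(λ-1); the summand 1 covers ‖x_{n+1}‖ < 2, where D(x_n) <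
  -- 1 suffices.
  refine ⟨(c + 1) * 2 ^ (lam - 1), by positivity, x, hprim, hmono, hanti, fun n => ?_⟩
  have hx1 : 1 ≤ ‖x (n + 1)‖ := one_le_norm_of_ne_zero (hprim _).ne_zero
  have hhalf : (2 : ℝ) ^ (lam - 1) * ‖x (n + 1)‖ ^ (-(lam - 1))
      = (‖x (n + 1)‖ / 2) ^ (-(lam - 1)) := by
    rw [div_rpow (by linarith) (by norm_num), rpow_neg (by norm_num : (0 : ℝ) ≤ 2)]
    field_simp
  rw [mul_assoc, hhalf]
  by_cases h2 : ‖x (n + 1)‖ < 2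
  · have : 1 ≤ (‖x (n + 1)‖ / 2) ^ (-(lam - 1)) :=
      one_le_rpow_of_pos_of_le_one_of_nonpos (by linarith) (by linarith) (by linarith)
    have h3 : projDist p ξ (x n) ≤ 1 :=
      (hanti.antitone (Nat.zero_le n)).trans hlt1.le
    nlinarith
  · obtain ⟨z, hz, hzX, hzD⟩ := h (‖x (n + 1)‖ / 2) (by linarith)
    have h3 : projDist p ξ (x n) ≤ projDist p ξ z := by
      by_contra! hlt
      have := hfmin _ (hpos n) z hz hlt
      rw [← hxs] at this
      linarith
    have : 0 < (‖x (n + 1)‖ / 2) ^ (-(lam - 1)) := rpow_pos_of_pos (by linarith) _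
    linarith

namespace IsMinimalSequence

variable {ξ : ℚ_[p]} {μ c : ℝ} {x : ℕ → Fin 3 → ℤ}

theorem one_le_norm (h : IsMinimalSequence p ξ μ c x) (n : ℕ) : 1 ≤ ‖x n‖ :=
  one_le_norm_of_ne_zero (h.primitive n).ne_zero

theorem injective (h : IsMinimalSequence p ξ μ c x) : Function.Injective x :=
  fun _ _ hmn => h.strictAnti.injective (congrArg (projDist p ξ) hmn)

theorem eventually_lt_norm (h : IsMinimalSequence p ξ μ c x) (R : ℝ) :
    ∃ N, ∀ n, N ≤ n → R < ‖x n‖ := by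
  by_contra! hcon
  refine Set.infinite_range_of_injective h.injective ((finite_setOf_norm_le R).subset ?_)
  rintro _ ⟨n, rfl⟩
  obtain ⟨m, hnm, hm⟩ := hcon n
  exact (h.monotone hnm).trans hm

theorem tendsto_norm (h : IsMinimalSequence p ξ μ c x) :
    Filter.Tendsto (fun n => ‖x n‖) Filter.atTop Filter.atTop :=
  Filter.tendsto_atTop_atTop.2 fun R =>
    let ⟨N, hN⟩ := h.eventually_lt_norm R
    ⟨N, fun n hn => (hN n hn).le⟩

theorem tendsto_projDist (h : IsMinimalSequence p ξ μ c x) (hμ : 0 < μ) :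
    Filter.Tendsto (fun n => projDist p ξ (x n)) Filter.atTop (nhds 0) := by
  have h1 : Filter.Tendsto (fun n => c * ‖x (n + 1)‖ ^ (-μ)) Filter.atTop (nhds (c * 0)) :=
    ((tendsto_rpow_neg_atTop hμ).comp
      (h.tendsto_norm.comp (Filter.tendsto_add_atTop_nat 1))).const_mul c
  rw [mul_zero] at h1
  exact squeeze_zero (fun n => projDist_nonneg ξ _) h.upper h1

theorem padicL_le_projDist (h : IsMinimalSequence p ξ μ c x) (n : ℕ) :
    padicL p ξ (x n) ≤ projDist p ξ (x n) :=
  le_mul_of_one_le_left (padicL_nonneg ξ _) (h.one_le_norm n)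

end IsMinimalSequence

end

/-! ### Primitive points and coplanarity -/

theorem eq_or_eq_neg_of_cross_eq_zero {x y : Fin 3 → ℤ} (hx : IsPrimitivePoint x)
    (hy : IsPrimitivePoint y) (h : crossProduct x y = 0) : x = y ∨ x = -y := by
  rw [cross_apply] at h
  have h0 := congrFun h 0
  have h1 := congrFun h 1
  have h2 := congrFun h 2
  simp at h0 h1 h2
  have hcomm : ∀ l m, y l * x m = x l * y m := by
    intro l m
    fin_cases l <;> fin_cases m <;> simp <;> linarith
  obtain ⟨l, hl⟩ := Function.ne_iff.1 hx.ne_zero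
  have hfun : (fun m => y l * x m) = fun m => x l * y m := funext (hcomm l)
  have hgcd : normalize (y l) = normalize (x l) := by
    have := congrArg (Finset.univ.gcd) hfun
    rwa [Finset.gcd_mul_left, Finset.gcd_mul_left, show Finset.univ.gcd x = 1 from hx,
      show (Finset.univ.gcd fun m => y m) = 1 from hy, mul_one, mul_one] at this
  have hl' : x l ≠ 0 := hl
  rcases Int.natAbs_eq_natAbs_iff.1 (Int.natAbs_eq_iff_associated.2
    ((normalize_eq_normalize_iff_associated).1 hgcd)) with e | e
  · left
    ext m
    have := hcomm l m
    rw [e] at this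
    exact mul_left_cancel₀ hl' this
  · right
    ext m
    have := hcomm l m
    rw [e] at this
    refine mul_left_cancel₀ hl' ?_
    simp only [Pi.neg_apply]
    linarith

theorem dot_eq_zero_iff_of_parallel {u v : Fin 3 → ℤ} (hu : u ≠ 0) (hv : v ≠ 0)
    (h : ∀ l m, u l * v m = u m * v l) (z : Fin 3 → ℤ) :
    u 0 * z 0 + u 1 * z 1 + u 2 * z 2 = 0 ↔ v 0 * z 0 + v 1 * z 1 + v 2 * z 2 = 0 := by
  obtain ⟨l, hl⟩ := Function.ne_iff.1 hu
  obtain ⟨m, hm⟩ := Function.ne_iff.1 hv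
  constructor
  · intro h0
    refine (mul_eq_zero.1 ?_).resolve_left hl
    linear_combination z 0 * h l 0 + z 1 * h l 1 + z 2 * h l 2 + v l * h0
  · intro h0
    refine (mul_eq_zero.1 ?_).resolve_left hm
    linear_combination z 0 * h 0 m + z 1 * h 1 m + z 2 * h 2 m + u m * h0

/-- If `a, b, c` are coplanar, the planes `⟨a, b⟩` and `⟨b, c⟩` coincide. -/
theorem det_eq_zero_iff_of_coplanar {a b c : Fin 3 → ℤ} (hab : crossProduct a b ≠ 0)
    (hbc : crossProduct b c ≠ 0) (h : (Matrix.of ![a, b, c]).det = 0) (z : Fin 3 → ℤ) :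
    (Matrix.of ![a, b, z]).det = 0 ↔ (Matrix.of ![b, c, z]).det = 0 := by
  rw [det_three_eq_cross, det_three_eq_cross]
  refine dot_eq_zero_iff_of_parallel hab hbc (fun l m => ?_) z
  rw [Matrix.det_fin_three] at h
  simp at h
  rw [cross_apply, cross_apply]
  fin_cases l <;> fin_cases m <;> simp
  · linear_combination b 2 * h
  · linear_combination -b 1 * h
  · linear_combination -b 2 * h
  · linear_combination b 0 * h
  · linear_combination b 1 * h
  · linear_combination -b 0 * h

theorem cross_cross_eq_smul {a b c e : Fin 3 → ℤ} (h : (Matrix.of ![a, b, c]).det = 0) :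
    crossProduct (crossProduct a b) (crossProduct c e) = (Matrix.of ![a, b, e]).det • c := by
  rw [Matrix.det_fin_three] at h ⊢
  simp at h ⊢
  rw [cross_apply a, cross_apply c, cross_apply]
  ext l
  fin_cases l <;> simp
  · linear_combination -e 0 * h
  · linear_combination -e 1 * h
  · linear_combination -e 2 * h

theorem det_swap_left (a b c : Fin 3 → ℤ) :
    (Matrix.of ![b, a, c]).det = -(Matrix.of ![a, b, c]).det := by
  rw [Matrix.det_fin_three, Matrix.det_fin_three]
  simp
  ring

theorem det_self_right (a b : Fin 3 → ℤ) : (Matrix.of ![a, b, b]).det = 0 := by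
  rw [Matrix.det_fin_three]
  simp
  ring

theorem det_self_outer (a b : Fin 3 → ℤ) : (Matrix.of ![a, b, a]).det = 0 := by
  rw [Matrix.det_fin_three]
  simp
  ring

theorem cross_swap_ne_zero {a b : Fin 3 → ℤ} (h : crossProduct a b ≠ 0) :
    crossProduct b a ≠ 0 := by
  rw [← cross_anticomm]
  exact neg_ne_zero.2 h

theorem IsPrimitivePoint.exists_not_dvd {x : Fin 3 → ℤ} (hx : IsPrimitivePoint x) {q : ℤ}
    (hq : Prime q) : ∃ l, ¬ q ∣ x l := by
  by_contra! h
  have : q ∣ Finset.univ.gcd x := Finset.dvd_gcd fun l _ => h l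
  rw [show Finset.univ.gcd x = 1 from hx] at this
  exact hq.not_dvd_one this

/-- A primitive point of determinant zero is, up to sign, of the form `(m², mn, n²)`. -/
theorem IsPrimitivePoint.exists_eq_sq_of_det_eq_zero {x : Fin 3 → ℤ} (hx : IsPrimitivePoint x)
    (h : x 0 * x 2 - x 1 ^ 2 = 0) :
    ∃ σ m n : ℤ, (σ = 1 ∨ σ = -1) ∧ x 0 = σ * m ^ 2 ∧ x 1 = σ * (m * n) ∧ x 2 = σ * n ^ 2 := by
  have h' : x 0 * x 2 = x 1 ^ 2 := by linarith
  have hcop : IsCoprime (x 0) (x 2) := by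
    refine isCoprime_of_prime_dvd ?_ ?_
    · rintro ⟨h0, h2⟩
      refine hx.ne_zero ?_
      rw [h0, zero_mul] at h'
      ext l
      fin_cases l
      exacts [h0, pow_eq_zero_iff (two_ne_zero) |>.1 h'.symm, h2]
    · intro q hq h0 h2
      obtain ⟨l, hl⟩ := hx.exists_not_dvd hq
      have h1 : q ∣ x 1 := hq.dvd_of_dvd_pow (h' ▸ Dvd.dvd.mul_right h0 _)
      fin_cases l
      exacts [hl h0, hl h1, hl h2]
  obtain ⟨a, ha⟩ := Int.sq_of_gcd_eq_one (Int.isCoprime_iff_gcd_eq_one.1 hcop) h'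
  obtain ⟨b, hb⟩ := Int.sq_of_gcd_eq_one (Int.isCoprime_iff_gcd_eq_one.1 hcop.symm)
    (by rw [mul_comm]; exact h')
  have hsame (σ : ℤ) (hσ : σ = 1 ∨ σ = -1) (h0 : x 0 = σ * a ^ 2) (h2 : x 2 = σ * b ^ 2) :
      ∃ σ m n : ℤ, (σ = 1 ∨ σ = -1) ∧ x 0 = σ * m ^ 2 ∧ x 1 = σ * (m * n) ∧
        x 2 = σ * n ^ 2 := by
    have hσ2 : σ ^ 2 = 1 := by rcases hσ with rfl | rfl <;> norm_num
    have h1 : x 1 ^ 2 = (σ * (a * b)) ^ 2 := by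
      rw [← h', h0, h2]; ring
    rcases sq_eq_sq_iff_eq_or_eq_neg.1 h1 with e | e
    · exact ⟨σ, a, b, hσ, h0, e, h2⟩
    · exact ⟨σ, a, -b, hσ, h0, by rw [e]; ring, by rw [h2]; ring⟩
  rcases ha with ha | ha <;> rcases hb with hb | hb
  · exact hsame 1 (Or.inl rfl) (by linarith) (by linarith)
  · have hz : x 1 ^ 2 = 0 := by
      have : x 1 ^ 2 = -(a * b) ^ 2 := by rw [← h', ha, hb]; ring
      nlinarith [sq_nonneg (x 1), sq_nonneg (a * b)]
    have hab : a * b = 0 := by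
      rw [ha, hb, hz] at h'; exact pow_eq_zero_iff two_ne_zero |>.1 (by linarith)
    rcases mul_eq_zero.1 hab with rfl | rfl
    · exact hsame (-1) (Or.inr rfl) (by rw [ha]; ring) (by linarith)
    · exact hsame 1 (Or.inl rfl) (by linarith) (by rw [hb]; ring)
  · have hz : x 1 ^ 2 = 0 := by
      have : x 1 ^ 2 = -(a * b) ^ 2 := by rw [← h', ha, hb]; ring
      nlinarith [sq_nonneg (x 1), sq_nonneg (a * b)]
    have hab : a * b = 0 := by
      rw [ha, hb, hz] at h'; exact pow_eq_zero_iff two_ne_zero |>.1 (by linarith)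
    rcases mul_eq_zero.1 hab with rfl | rfl
    · exact hsame 1 (Or.inl rfl) (by rw [ha]; ring) (by linarith)
    · exact hsame (-1) (Or.inr rfl) (by linarith) (by rw [hb]; ring)
  · exact hsame (-1) (Or.inr rfl) (by linarith) (by linarith)

/-! ### Size constraints from non-vanishing integers -/

section

variable {p : ℕ} [hp : Fact p.Prime]

theorem IsPrimitivePoint.exists_norm_eq_one {x : Fin 3 → ℤ} (hx : IsPrimitivePoint x) :
    ∃ l, ‖((x l : ℤ) : ℚ_[p])‖ = 1 := by
  obtain ⟨l, hl⟩ := hx.exists_not_dvd (Nat.prime_iff_prime_int.1 hp.out)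
  exact ⟨l, le_antisymm (Padic.norm_int_le_one _)
    (not_lt.1 fun h => hl (Padic.norm_intCast_lt_one_iff.1 h))⟩

theorem absProd_det_two_le {ξ : ℚ_[p]} {B : ℝ} (hB : 1 ≤ B) (hξ : ‖ξ‖ ≤ B) (x : Fin 3 → ℤ) :
    absProd p (symMat x).det ≤ 2 * B * (‖x‖ * projDist p ξ x) := by
  rw [det_symMat]
  calc absProd p (x 0 * x 2 - x 1 ^ 2) ≤ (2 * ‖x‖ ^ 2) * (B * padicL p ξ x) :=
        mul_le_mul (abs_det_two_le x) (norm_det_two_le hB hξ x) (norm_nonneg _) (by positivity)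
    _ = _ := by rw [projDist]; ring

theorem mul_max_padicL_le {ξ : ℚ_[p]} {x y : Fin 3 → ℤ} (hxy : ‖x‖ ≤ ‖y‖)
    (hD : projDist p ξ y ≤ projDist p ξ x) :
    ‖x‖ * max (padicL p ξ x) (padicL p ξ y) ≤ projDist p ξ x := by
  rw [mul_max_of_nonneg _ _ (norm_nonneg _)]
  refine max_le le_rfl (le_trans ?_ hD)
  exact mul_le_mul_of_nonneg_right hxy (padicL_nonneg ξ y)

theorem absProd_det_three_le {ξ : ℚ_[p]} {x y z : Fin 3 → ℤ} (hx : x ≠ 0)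
    (hxy : ‖x‖ ≤ ‖y‖) (hyz : ‖y‖ ≤ ‖z‖) (hD : projDist p ξ y ≤ projDist p ξ x)
    (hD' : projDist p ξ z ≤ projDist p ξ y) :
    absProd p (Matrix.of ![x, y, z]).det ≤ 6 * (‖z‖ * projDist p ξ x * projDist p ξ y) := by
  have hX : 0 < ‖x‖ := norm_pos_iff.2 hx
  have hY : 0 < ‖y‖ := hX.trans_le hxy
  have hZ : 0 < ‖z‖ := hY.trans_le hyz
  have hDx := projDist_nonneg ξ x
  have hDy := projDist_nonneg ξ y
  have hDz := projDist_nonneg ξ z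
  have hLx := padicL_nonneg ξ x
  have hLy := padicL_nonneg ξ y
  have hLz := padicL_nonneg ξ z
  set m := ‖z‖ * projDist p ξ x * projDist p ξ y / (‖x‖ * ‖y‖ * ‖z‖) with hm
  have hpad : ‖(((Matrix.of ![x, y, z]).det : ℤ) : ℚ_[p])‖ ≤ m := by
    refine norm_det_three_le (ξ := ξ) (Padic.norm_int_le_one _) le_rfl le_rfl le_rfl ?_ ?_ ?_
    · rw [hm, le_div_iff₀ (by positivity)]
      calc 1 * (padicL p ξ y * padicL p ξ z) * (‖x‖ * ‖y‖ * ‖z‖)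
          = ‖x‖ * projDist p ξ y * projDist p ξ z := by rw [projDist, projDist]; ring
        _ ≤ ‖z‖ * projDist p ξ x * projDist p ξ y := by
          gcongr
          exact hxy.trans hyz
    · rw [hm, le_div_iff₀ (by positivity)]
      calc padicL p ξ x * padicL p ξ z * (‖x‖ * ‖y‖ * ‖z‖)
          = ‖y‖ * projDist p ξ x * projDist p ξ z := by rw [projDist, projDist]; ring
        _ ≤ ‖z‖ * projDist p ξ x * projDist p ξ y := by gcongr
    · rw [hm, le_div_iff₀ (by positivity)]
      refine le_of_eq ?_
      rw [projDist, projDist]; ring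
  calc absProd p (Matrix.of ![x, y, z]).det ≤ 6 * (‖x‖ * ‖y‖ * ‖z‖) * m :=
        mul_le_mul (abs_det_three_le x y z) hpad (norm_nonneg _) (by positivity)
    _ = _ := by rw [hm]; field_simp

/-- The cross product of the normals of ⟨a, b⟩ and ⟨c, e⟩ is an integer multiple d • c with d ≠ 0. A
unit coordinate of the primitive c makes |d|_p readable from that product, and |d|_∞|d|_p ≥ 1
finishes. -/
theorem norm_le_of_planes_meet {ξ : ℚ_[p]} {B : ℝ} (hB : 1 ≤ B) (hξ : ‖ξ‖ ≤ B)
    {a b c e : Fin 3 → ℤ} (hc : IsPrimitivePoint c) (hab : ‖a‖ ≤ ‖b‖) (hce : ‖c‖ ≤ ‖e‖)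
    (hDab : projDist p ξ b ≤ projDist p ξ a) (hDce : projDist p ξ e ≤ projDist p ξ c)
    (h0 : (Matrix.of ![a, b, c]).det = 0) (h1 : (Matrix.of ![a, b, e]).det ≠ 0) :
    ‖c‖ ≤ 8 * B ^ 4 * ((‖b‖ * projDist p ξ a) * (‖e‖ * projDist p ξ c)) := by
  set d := (Matrix.of ![a, b, e]).det with hd
  have hsmul : crossProduct (crossProduct a b) (crossProduct c e) = d • c :=
    cross_cross_eq_smul h0
  have hinf : |(d : ℝ)| * ‖c‖ ≤ 2 * ((2 * (‖a‖ * ‖b‖)) * (2 * (‖c‖ * ‖e‖))) := by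
    rw [← Int.norm_eq_abs, ← norm_smul, ← hsmul]
    refine (norm_cross_le_two_mul _ _).trans ?_
    gcongr <;> exact norm_cross_le_two_mul _ _
  have hpad : ‖(d : ℚ_[p])‖ ≤ (B ^ 2 * max (padicL p ξ a) (padicL p ξ b)) *
      (B ^ 2 * max (padicL p ξ c) (padicL p ξ e)) := by
    obtain ⟨l, hl⟩ := hc.exists_norm_eq_one (p := p)
    have hdl : ‖(d : ℚ_[p])‖ = ‖((crossProduct (crossProduct a b) (crossProduct c e) l : ℤ) : ℚ_[p])‖ := by
      rw [hsmul]
      simp [hl]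
    have hu (i) := norm_cross_le hB hξ (le_max_left (padicL p ξ a) (padicL p ξ b))
      (le_max_right _ _) i
    have hv (i) := norm_cross_le hB hξ (le_max_left (padicL p ξ c) (padicL p ξ e))
      (le_max_right _ _) i
    rw [hdl, cross_apply]
    have key (i j m n : Fin 3) : ‖((crossProduct a b i * crossProduct c e j
        - crossProduct a b m * crossProduct c e n : ℤ) : ℚ_[p])‖ ≤
        (B ^ 2 * max (padicL p ξ a) (padicL p ξ b)) *
          (B ^ 2 * max (padicL p ξ c) (padicL p ξ e)) := by
      push_cast
      exact padic_norm_sub_le (padic_norm_mul_le (hu i) (hv j) le_rfl)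
        (padic_norm_mul_le (hu m) (hv n) le_rfl)
    fin_cases l
    exacts [key 1 2 2 1, key 2 0 0 2, key 0 1 1 0]
  have hLa : 0 ≤ max (padicL p ξ a) (padicL p ξ b) := le_max_of_le_left (padicL_nonneg ξ a)
  have hLc : 0 ≤ max (padicL p ξ c) (padicL p ξ e) := le_max_of_le_left (padicL_nonneg ξ c)
  calc ‖c‖ ≤ absProd p d * ‖c‖ :=
        le_mul_of_one_le_left (norm_nonneg _) (one_le_absProd p h1)
    _ = (|(d : ℝ)| * ‖c‖) * ‖(d : ℚ_[p])‖ := by rw [absProd]; ring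
    _ ≤ (2 * ((2 * (‖a‖ * ‖b‖)) * (2 * (‖c‖ * ‖e‖)))) *
        ((B ^ 2 * max (padicL p ξ a) (padicL p ξ b)) *
          (B ^ 2 * max (padicL p ξ c) (padicL p ξ e))) :=
        mul_le_mul hinf hpad (norm_nonneg _) (by positivity)
    _ = 8 * B ^ 4 * ((‖b‖ * (‖a‖ * max (padicL p ξ a) (padicL p ξ b))) *
        (‖e‖ * (‖c‖ * max (padicL p ξ c) (padicL p ξ e)))) := by ring
    _ ≤ _ := by
        have := projDist_nonneg ξ a
        gcongr
        · exact mul_max_padicL_le hab hDab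
        · exact mul_max_padicL_le hce hDce

/-- A degenerate x is ±(m², mn, n²) with m, n of size at most ‖x‖^(1/2) and n - mξ as small as
L_p(x). One of my₁ - ny₀, my₂ - ny₁ is non-zero because x and y are independent, and squaring its
Liouville bound gives the claim. -/
theorem one_le_of_det_eq_zero {ξ : ℚ_[p]} {B : ℝ} (hB : 1 ≤ B) (hξ : ‖ξ‖ ≤ B)
    {x y : Fin 3 → ℤ} (hx : IsPrimitivePoint x) (hxy : crossProduct x y ≠ 0)
    (hle : ‖y‖ ≤ ‖x‖) (hD : projDist p ξ x ≤ projDist p ξ y)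
    (h : (symMat x).det = 0) :
    1 ≤ 4 * B ^ 4 * (‖x‖ * projDist p ξ y ^ 2) := by
  rw [det_symMat] at h
  obtain ⟨σ, m, n, hσ, h0, h1, h2⟩ := hx.exists_eq_sq_of_det_eq_zero h
  have hB0 : 0 < B := by linarith
  have hσ' : ‖(σ : ℚ_[p])‖ = 1 := by rcases hσ with rfl | rfl <;> simp
  have hσ0 : σ ≠ 0 := by rcases hσ with rfl | rfl <;> simp
  have hσa : |(σ : ℝ)| = 1 := by rcases hσ with rfl | rfl <;> simp
  have hLx := padicL_nonneg ξ x
  have hLy := padicL_nonneg ξ y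
  have e1 := norm_error_one_le ξ x
  have e2 := norm_error_two_le ξ x
  have i (a : ℤ) : ‖(a : ℚ_[p])‖ ≤ 1 := Padic.norm_int_le_one a
  -- the approximation `n - m ξ`
  have hε : ‖(n : ℚ_[p]) - m * ξ‖ ≤ B * padicL p ξ x := by
    have k1 : ‖(m : ℚ_[p])‖ * ‖(n : ℚ_[p]) - m * ξ‖ ≤ padicL p ξ x := by
      calc _ = ‖(σ : ℚ_[p])‖ * (‖(m : ℚ_[p])‖ * ‖(n : ℚ_[p]) - m * ξ‖) := by rw [hσ', one_mul]
        _ = ‖(x 1 : ℚ_[p]) - x 0 * ξ‖ := by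
          rw [← norm_mul, ← norm_mul, h0, h1]; push_cast; ring_nf
        _ ≤ _ := e1
    have k2 : ‖(n : ℚ_[p]) + m * ξ‖ * ‖(n : ℚ_[p]) - m * ξ‖ ≤ padicL p ξ x := by
      calc _ = ‖(σ : ℚ_[p])‖ * (‖(n : ℚ_[p]) + m * ξ‖ * ‖(n : ℚ_[p]) - m * ξ‖) := by
            rw [hσ', one_mul]
        _ = ‖(x 2 : ℚ_[p]) - x 0 * ξ ^ 2‖ := by
          rw [← norm_mul, ← norm_mul, h0, h2]; push_cast; ring_nf
        _ ≤ _ := e2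
    -- If m is not p-adically small, divide it out of x₁ - x₀ξ; otherwise n and n + mξ are units and
    -- x₂ - x₀ξ² gives the bound.
    by_cases hm : 1 ≤ B * ‖(m : ℚ_[p])‖
    · nlinarith [norm_nonneg ((n : ℚ_[p]) - m * ξ)]
    · push Not at hm
      have hn : ‖(n : ℚ_[p])‖ = 1 := by
        refine le_antisymm (i n) (not_lt.1 fun hn => ?_)
        have hpm : (p : ℤ) ∣ m := Padic.norm_intCast_lt_one_iff.1 (by nlinarith [norm_nonneg (m : ℚ_[p])])
        have hpn : (p : ℤ) ∣ n := Padic.norm_intCast_lt_one_iff.1 hn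
        obtain ⟨l, hl⟩ := hx.exists_not_dvd (Nat.prime_iff_prime_int.1 hp.out)
        fin_cases l
        · exact hl (by simp only [Fin.zero_eta, h0]; exact ((dvd_pow hpm two_ne_zero).mul_left _))
        · exact hl (by simp only [Fin.mk_one, h1]; exact (hpm.mul_right _).mul_left _)
        · exact hl (by simp only [Fin.reduceFinMk, h2]; exact ((dvd_pow hpn two_ne_zero).mul_left _))
      have hmξ : ‖(m : ℚ_[p]) * ξ‖ < 1 := by
        rw [norm_mul]; nlinarith [norm_nonneg (m : ℚ_[p])]
      have hsum : ‖(n : ℚ_[p]) + m * ξ‖ = 1 := by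
        rw [Padic.add_eq_max_of_ne (by rw [hn]; exact hmξ.ne'), hn, max_eq_left hmξ.le]
      rw [hsum, one_mul] at k2
      nlinarith
  -- a lower bound for the size of `(m, n)`
  obtain ⟨s, hs0, hsm, hsn, hsx⟩ : ∃ s : ℝ, 0 ≤ s ∧ |(m : ℝ)| ≤ s ∧ |(n : ℝ)| ≤ s ∧
      s ^ 2 ≤ ‖x‖ := by
    refine ⟨max |(m : ℝ)| |(n : ℝ)|, le_max_of_le_left (abs_nonneg _), le_max_left _ _,
      le_max_right _ _, ?_⟩
    have a0 := abs_coord_le_norm x 0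
    have a2 := abs_coord_le_norm x 2
    rw [h0] at a0
    rw [h2] at a2
    push_cast at a0 a2
    rw [abs_mul, hσa, one_mul, abs_pow] at a0 a2
    rcases max_choice |(m : ℝ)| |(n : ℝ)| with e | e <;> rw [e] <;> assumption
  set r := max (padicL p ξ x) (padicL p ξ y) with hr
  have hr0 : 0 ≤ r := le_max_of_le_left hLx
  have hBr1 : r ≤ B ^ 2 * r := le_mul_of_one_le_left hr0 (one_le_pow₀ hB)
  have hBr2 : B * r ≤ B ^ 2 * r := mul_le_mul_of_nonneg_right (by nlinarith) hr0
  have hεr : ‖(n : ℚ_[p]) - m * ξ‖ ≤ B * r := hε.trans (by gcongr; exact le_max_left _ _)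
  have f1 : ‖(y 1 : ℚ_[p]) - y 0 * ξ‖ ≤ r := (norm_error_one_le ξ y).trans (le_max_right _ _)
  have f2 : ‖(y 2 : ℚ_[p]) - y 0 * ξ ^ 2‖ ≤ r := (norm_error_two_le ξ y).trans (le_max_right _ _)
  have hfin (u : ℤ) (hu : u ≠ 0) (hinf : |(u : ℝ)| ≤ 2 * (s * ‖y‖))
      (hpad : ‖(u : ℚ_[p])‖ ≤ B ^ 2 * r) : 1 ≤ 4 * B ^ 4 * (‖x‖ * projDist p ξ y ^ 2) := by
    have hyr : ‖y‖ * r ≤ projDist p ξ y := by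
      rw [hr, max_comm]; exact mul_max_padicL_le hle hD
    have hone : 1 ≤ 2 * B ^ 2 * (s * (‖y‖ * r)) :=
      calc 1 ≤ absProd p u := one_le_absProd p hu
        _ ≤ (2 * (s * ‖y‖)) * (B ^ 2 * r) :=
          mul_le_mul hinf hpad (norm_nonneg _) (by positivity)
        _ = _ := by ring
    calc (1 : ℝ) ≤ (2 * B ^ 2 * (s * (‖y‖ * r))) ^ 2 := one_le_pow₀ hone
      _ = 4 * B ^ 4 * (s ^ 2 * (‖y‖ * r) ^ 2) := by ring
      _ ≤ _ := by gcongr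
  have habs (j l : Fin 3) : |((m * y j - n * y l : ℤ) : ℝ)| ≤ 2 * (s * ‖y‖) := by
    push_cast
    refine (abs_sub _ _).trans ?_
    rw [abs_mul, abs_mul]
    have := mul_le_mul hsm (abs_coord_le_norm y j) (abs_nonneg _) hs0
    have := mul_le_mul hsn (abs_coord_le_norm y l) (abs_nonneg _) hs0
    linarith
  by_cases hu : m * y 1 - n * y 0 = 0
  · by_cases hv : m * y 2 - n * y 1 = 0
    · refine absurd ?_ hxy
      rw [cross_apply, h0, h1, h2]
      ext l
      fin_cases l <;> simp
      · linear_combination σ * n * hv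
      · linear_combination -σ * m * hv - σ * n * hu
      · linear_combination σ * m * hu
    · refine hfin _ hv (habs 2 1) ?_
      have key : ((m * y 2 - n * y 1 : ℤ) : ℚ_[p]) = m * (y 2 - y 0 * ξ ^ 2)
          - n * (y 1 - y 0 * ξ) - y 0 * (ξ * (n - m * ξ)) := by
        push_cast; ring
      rw [key]
      refine padic_norm_sub_le (padic_norm_sub_le ?_ ?_) ?_
      · exact padic_norm_mul_le (i _) f2 (by rwa [one_mul])
      · exact padic_norm_mul_le (i _) f1 (by rwa [one_mul])
      · exact padic_norm_mul_le (i _) (padic_norm_mul_le hξ hεr le_rfl)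
          (by rw [one_mul, ← mul_assoc, pow_two])
  · refine hfin _ hu (habs 1 0) ?_
    have key : ((m * y 1 - n * y 0 : ℤ) : ℚ_[p]) = m * (y 1 - y 0 * ξ)
        - y 0 * (n - m * ξ) := by
      push_cast; ring
    rw [key]
    exact padic_norm_sub_le (padic_norm_mul_le (i _) f1 (by rwa [one_mul]))
      (padic_norm_mul_le (i _) hεr (by rwa [one_mul]))

end

/-! ### From the constraints to growth exponents -/

theorem exists_enumeration {P : ℕ → Prop} (h : ∀ N, ∃ n, N ≤ n ∧ P n) :
    ∃ ι : ℕ → ℕ, StrictMono ι ∧ (∀ k, P (ι k)) ∧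
      ∀ k m, ι k < m → m < ι (k + 1) → ¬ P m := by
  classical
  have hinf : (Set.ofPred P).Infinite := Set.infinite_of_not_bddAbove fun ⟨N, hN⟩ => by
    obtain ⟨n, hn, hPn⟩ := h (N + 1)
    have := hN hPn
    omega
  refine ⟨Nat.nth P, Nat.nth_strictMono hinf, Nat.nth_mem_of_infinite hinf, fun k m h1 h2 hm => ?_⟩
  rw [← Nat.nth_count hm] at h1 h2
  have := (Nat.nth_strictMono hinf).lt_iff_lt.1 h1
  have := (Nat.nth_strictMono hinf).lt_iff_lt.1 h2
  omega

theorem le_exp_mul_rpow_of_log_le {X Y C e : ℝ} (hX : 0 < X) (hY : 0 < Y)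
    (h : log X ≤ C + e * log Y) : X ≤ exp C * Y ^ e := by
  rw [rpow_def_of_pos hY, ← exp_add, mul_comm (log Y)]
  exact (log_le_iff_le_exp hX).1 h

/-- Here a, a', d are the logarithms of ‖x_{i+1}‖, ‖x_{i+2}‖, D(x_{i+1}) at the k-th selected i, μ =
λ - 1, and μ/(1-μ) is θ. The hypotheses encode minimality, the triple determinant, det(y_k) ≠ 0,
monotonicity and the meeting planes. For the upper bound, `h5` with `h1` bounds a(k+1) by a'(k) and
a'(k+1), which `h3` bounds by a(k) and a(k+1); μ > 1/2 lets a(k+1) be solved for. -/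
theorem growth_bounds {a a' d : ℕ → ℝ} {μ c : ℝ} (hμ : 1 / 2 < μ) (hμ1 : μ < 1)
    (h1 : ∀ k, d k ≤ c - μ * a' k) (h2 : ∀ k, μ * a k ≤ 3 * c + (1 - μ) * a' k)
    (h3 : ∀ k, 0 ≤ c + a k + d k) (h4 : ∀ k, a' k ≤ a (k + 1))
    (h5 : ∀ k, a (k + 1) ≤ c + (a' k + d k) + (a' (k + 1) + d (k + 1))) :
    ∃ C : ℝ, 0 ≤ C ∧
      (∀ k, μ / (1 - μ) * a k ≤ C + a (k + 1)) ∧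
      (∀ k, a (k + 1) ≤ C + 1 / (μ / (1 - μ) - 1) * a k) ∧
      (∀ k, d k ≤ C - (μ / (1 - μ)) ^ 2 / (μ / (1 - μ) + 1) * a k) := by
  have hν : 0 < 1 - μ := by linarith
  have hν2 : 0 < 2 * μ - 1 := by linarith
  have hexp : (μ / (1 - μ)) ^ 2 / (μ / (1 - μ) + 1) = μ * (μ / (1 - μ)) := by
    rw [show μ / (1 - μ) + 1 = 1 / (1 - μ) by field_simp; ring]
    field_simp
  have hexp' : 1 / (μ / (1 - μ) - 1) = (1 - μ) / (2 * μ - 1) := by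
    rw [show μ / (1 - μ) - 1 = (2 * μ - 1) / (1 - μ) by field_simp; ring, one_div_div]
  have hlow : ∀ k, μ / (1 - μ) * a k ≤ 3 * |c| / (1 - μ) + a' k := by
    intro k
    have h2k := h2 k
    have hc := le_abs_self c
    rw [div_mul_eq_mul_div, div_add' _ _ _ hν.ne']
    gcongr
    linarith
  refine ⟨max (3 * |c| / (1 - μ)) (max (7 * |c| / (2 * μ - 1)) (|c| + μ * (3 * |c| / (1 - μ)))),
    le_max_of_le_left (by positivity), fun k => ?_, fun k => ?_, fun k => ?_⟩
  · linarith [hlow k, h4 k, le_max_left (3 * |c| / (1 - μ))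
      (max (7 * |c| / (2 * μ - 1)) (|c| + μ * (3 * |c| / (1 - μ))))]
  · have key : a (k + 1) ≤ 7 * |c| / (2 * μ - 1) + 1 / (μ / (1 - μ) - 1) * a k := by
      rw [hexp', div_mul_eq_mul_div, ← add_div, le_div_iff₀ hν2]
      have hc := le_abs_self c
      have e1 : a (k + 1) ≤ 3 * c + (1 - μ) * (a' k + a' (k + 1)) := by
        linarith [h5 k, h1 k, h1 (k + 1)]
      have e2 : μ * a' k ≤ 2 * c + a k := by linarith [h1 k, h3 k]
      have e3 : μ * a' (k + 1) ≤ 2 * c + a (k + 1) := by linarith [h1 (k + 1), h3 (k + 1)]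
      have e4 := mul_le_mul_of_nonneg_left e1 (by linarith : 0 ≤ μ)
      have e5 := mul_le_mul_of_nonneg_left (add_le_add e2 e3) hν.le
      have e6 : (4 - μ) * c ≤ 7 * |c| := by
        have := abs_nonneg c
        nlinarith
      linarith
    exact key.trans (by gcongr; exact (le_max_left _ _).trans (le_max_right _ _))
  · have key : d k ≤ (|c| + μ * (3 * |c| / (1 - μ)))
        - (μ / (1 - μ)) ^ 2 / (μ / (1 - μ) + 1) * a k := by
      rw [hexp]
      have := mul_le_mul_of_nonneg_left (hlow k) (by linarith : 0 ≤ μ)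
      linarith [h1 k, le_abs_self c]
    exact key.trans (by gcongr; exact (le_max_right _ _).trans (le_max_right _ _))

/-! ### Non-degeneracy along a minimal sequence -/

section

variable {p : ℕ} [hp : Fact p.Prime] {ξ : ℚ_[p]} {μ c : ℝ} {x : ℕ → Fin 3 → ℤ}

/-- Up to errors z is z₀(1, ξ, ξ²), and z₀ cannot be p-adically tiny, since all coordinates of the
primitive z would then be divisible by p. -/
theorem norm_linear_form_le_of_orthogonal {B : ℝ} (hB : 1 ≤ B) (hξ : ‖ξ‖ ≤ B)
    {w z : Fin 3 → ℤ} (hz : IsPrimitivePoint z) (hL : padicL p ξ z < 1)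
    (h : w 0 * z 0 + w 1 * z 1 + w 2 * z 2 = 0) :
    ‖(w 0 : ℚ_[p]) + w 1 * ξ + w 2 * ξ ^ 2‖ ≤ B ^ 2 * padicL p ξ z := by
  have i (a : ℤ) : ‖(a : ℚ_[p])‖ ≤ 1 := Padic.norm_int_le_one a
  have hB2 : (1 : ℝ) ≤ B ^ 2 := one_le_pow₀ hB
  have hL0 := padicL_nonneg ξ z
  have hξ2 : ‖ξ ^ 2‖ ≤ B ^ 2 := by
    rw [norm_pow]; exact pow_le_pow_left₀ (norm_nonneg _) hξ 2
  have hz0 : 1 ≤ B ^ 2 * ‖(z 0 : ℚ_[p])‖ := by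
    by_contra! hlt
    have k0 : ‖(z 0 : ℚ_[p])‖ < 1 := by nlinarith [norm_nonneg (z 0 : ℚ_[p])]
    have k1 : ‖(z 0 : ℚ_[p]) * ξ‖ < 1 := by
      rw [norm_mul]
      have := mul_le_mul_of_nonneg_left hξ (norm_nonneg (z 0 : ℚ_[p]))
      nlinarith [norm_nonneg (z 0 : ℚ_[p])]
    have k2 : ‖(z 0 : ℚ_[p]) * ξ ^ 2‖ < 1 := by
      rw [norm_mul]
      have := mul_le_mul_of_nonneg_left hξ2 (norm_nonneg (z 0 : ℚ_[p]))
      nlinarith [norm_nonneg (z 0 : ℚ_[p])]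
    have hadd (u v : ℚ_[p]) (hu : ‖u‖ < 1) (huv : ‖v - u‖ < 1) : ‖v‖ ≠ 1 := by
      have := Padic.nonarchimedean (v - u) u
      rw [sub_add_cancel] at this
      exact (this.trans_lt (max_lt huv hu)).ne
    obtain ⟨l, hl⟩ := hz.exists_norm_eq_one (p := p)
    fin_cases l
    · exact k0.ne hl
    · exact hadd _ _ k1 ((norm_error_one_le ξ z).trans_lt hL) hl
    · exact hadd _ _ k2 ((norm_error_two_le ξ z).trans_lt hL) hl
  have key : (z 0 : ℚ_[p]) * (w 0 + w 1 * ξ + w 2 * ξ ^ 2) =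
      -(w 1 * (z 1 - z 0 * ξ) + w 2 * (z 2 - z 0 * ξ ^ 2)) := by
    have h' : (w 0 : ℚ_[p]) * z 0 + w 1 * z 1 + w 2 * z 2 = 0 := by exact_mod_cast h
    linear_combination h'
  have hle : ‖(z 0 : ℚ_[p])‖ * ‖(w 0 : ℚ_[p]) + w 1 * ξ + w 2 * ξ ^ 2‖ ≤ padicL p ξ z := by
    rw [← norm_mul, key, norm_neg]
    exact padic_norm_add_le (padic_norm_mul_le (i _) (norm_error_one_le ξ z) (one_mul _).le)
      (padic_norm_mul_le (i _) (norm_error_two_le ξ z) (one_mul _).le)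
  calc _ ≤ (B ^ 2 * ‖(z 0 : ℚ_[p])‖) * ‖(w 0 : ℚ_[p]) + w 1 * ξ + w 2 * ξ ^ 2‖ :=
        le_mul_of_one_le_left (norm_nonneg _) hz0
    _ ≤ _ := by rw [mul_assoc]; gcongr

namespace IsMinimalSequence

theorem cross_ne_zero (h : IsMinimalSequence p ξ μ c x) {m n : ℕ} (hmn : m ≠ n) :
    crossProduct (x m) (x n) ≠ 0 := by
  intro h0
  refine hmn (h.strictAnti.injective ?_)
  rcases eq_or_eq_neg_of_cross_eq_zero (h.primitive m) (h.primitive n) h0 with e | e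
  · exact congrArg (projDist p ξ) e
  · simp only [e, projDist_neg]

theorem eventually_det_ne_zero (h : IsMinimalSequence p ξ μ c x) (hμ : 1 / 2 < μ) :
    ∃ N, ∀ n, N ≤ n → (symMat (x n)).det ≠ 0 := by
  set B := max 1 ‖ξ‖
  have hB : 1 ≤ B := le_max_left _ _
  have ht : Filter.Tendsto (fun n => 4 * B ^ 4 * c ^ 2 * ‖x n‖ ^ (-(2 * μ - 1))) Filter.atTop
      (nhds (4 * B ^ 4 * c ^ 2 * 0)) :=
    ((tendsto_rpow_neg_atTop (by linarith)).comp h.tendsto_norm).const_mul _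
  rw [mul_zero] at ht
  obtain ⟨N, hN⟩ := Filter.eventually_atTop.1 (ht.eventually_lt_const one_pos)
  refine ⟨N + 1, fun n hn h0 => ?_⟩
  obtain ⟨n, rfl⟩ : ∃ k, n = k + 1 := ⟨n - 1, by omega⟩
  have h1 := one_le_of_det_eq_zero hB (le_max_right _ _) (h.primitive (n + 1))
    (h.cross_ne_zero (Nat.succ_ne_self n)) (h.monotone (Nat.le_succ n))
    (h.strictAnti.antitone (Nat.le_succ n)) h0
  have hX : 0 < ‖x (n + 1)‖ := one_pos.trans_le (h.one_le_norm _)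
  have h2 : ‖x (n + 1)‖ * projDist p ξ (x n) ^ 2 ≤ c ^ 2 * ‖x (n + 1)‖ ^ (-(2 * μ - 1)) := by
    calc _ ≤ ‖x (n + 1)‖ * (c * ‖x (n + 1)‖ ^ (-μ)) ^ 2 := by
          have := projDist_nonneg ξ (x n)
          gcongr
          exact h.upper n
      _ = c ^ 2 * (‖x (n + 1)‖ ^ (-μ) * ‖x (n + 1)‖ ^ (-μ) * ‖x (n + 1)‖) := by ring
      _ = _ := by
          rw [← rpow_add hX, ← rpow_add_one hX.ne']
          ring_nf
  have h3 := hN (n + 1) (by omega)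
  have h4 := mul_le_mul_of_nonneg_left h2 (by positivity : 0 ≤ 4 * B ^ 4)
  linarith

theorem plane_eq (h : IsMinimalSequence p ξ μ c x) {m n : ℕ} (hmn : m ≤ n)
    (hcop : ∀ l, m ≤ l → l < n → (Matrix.of ![x l, x (l + 1), x (l + 2)]).det = 0)
    (z : Fin 3 → ℤ) :
    (Matrix.of ![x m, x (m + 1), z]).det = 0 ↔ (Matrix.of ![x n, x (n + 1), z]).det = 0 := by
  induction n, hmn using Nat.le_induction with
  | base => rfl
  | succ n hmn ih =>
    rw [ih fun l h1 h2 => hcop l h1 (by omega)]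
    exact det_eq_zero_iff_of_coplanar (h.cross_ne_zero (by omega)) (h.cross_ne_zero (by omega))
      (hcop n hmn (by omega)) z

theorem exists_det_three_ne_zero (h : IsMinimalSequence p ξ μ c x) (hμ : 0 < μ)
    (hξ : 2 < Module.rank ℚ (IntermediateField.adjoin ℚ {ξ})) (N : ℕ) :
    ∃ n, N ≤ n ∧ (Matrix.of ![x n, x (n + 1), x (n + 2)]).det ≠ 0 := by
  -- Otherwise all later points lie in one plane; its integer normal w then gives w₀ + w₁ξ + w₂ξ² =
  -- 0 in the limit, an excluded quadratic relation.
  by_contra! hcon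
  set w := crossProduct (x N) (x (N + 1)) with hw
  have hw0 : w ≠ 0 := h.cross_ne_zero (by omega)
  set B := max 1 ‖ξ‖
  have hB : 1 ≤ B := le_max_left _ _
  have horth : ∀ n, N ≤ n → w 0 * x n 0 + w 1 * x n 1 + w 2 * x n 2 = 0 := by
    intro n hn
    rw [hw, ← det_three_eq_cross, h.plane_eq hn (fun l h1 _ => hcon l h1)]
    exact det_self_outer _ _
  have ht := h.tendsto_projDist hμ
  have hzero : ‖(w 0 : ℚ_[p]) + w 1 * ξ + w 2 * ξ ^ 2‖ ≤ B ^ 2 * 0 := by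
    refine ge_of_tendsto (ht.const_mul (B ^ 2)) ?_
    filter_upwards [ht.eventually_lt_const one_pos, Filter.eventually_ge_atTop N] with n h1 hn
    refine (norm_linear_form_le_of_orthogonal hB (le_max_right _ _) (h.primitive n)
      ((h.padicL_le_projDist n).trans_lt h1) (horth n hn)).trans ?_
    gcongr
    exact h.padicL_le_projDist n
  rw [mul_zero, norm_le_zero_iff] at hzero
  obtain ⟨e0, e1, e2⟩ := int_relation_eq_zero hξ hzero
  refine hw0 ?_
  ext l
  fin_cases l
  exacts [e0, e1, e2]

end IsMinimalSequence

end

/-! ### Construction of the sequence and conclusion -/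

theorem det_three_ne_zero_of_planes {a a' b b' e : Fin 3 → ℤ} (haa' : crossProduct a a' ≠ 0)
    (hab : crossProduct a b ≠ 0) (hbb' : crossProduct b b' ≠ 0) (hbe : crossProduct b e ≠ 0)
    (h1 : (Matrix.of ![a, a', b]).det = 0) (h2 : (Matrix.of ![b, b', e]).det = 0)
    (h3 : (Matrix.of ![a, a', b']).det ≠ 0) : (Matrix.of ![a, b, e]).det ≠ 0 := by
  intro h0
  refine h3 ?_
  rw [← neg_eq_zero, ← det_swap_left] at h1 h2 ⊢
  rw [det_eq_zero_iff_of_coplanar (cross_swap_ne_zero haa') hab h1,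
    det_eq_zero_iff_of_coplanar hab hbe h0,
    ← det_eq_zero_iff_of_coplanar (cross_swap_ne_zero hbb') hbe h2]
  exact det_self_outer _ _

theorem IsMinimalSequence.exists_isApproxSequence {p : ℕ} [Fact p.Prime] {ξ : ℚ_[p]}
    {lam c₀ : ℝ} {x : ℕ → Fin 3 → ℤ} (h : IsMinimalSequence p ξ (lam - 1) c₀ x) (hc₀ : 0 < c₀)
    (hξ : 2 < Module.rank ℚ (IntermediateField.adjoin ℚ {ξ})) (hlam : 3 / 2 < lam)
    (hlam2 : lam < 2) : ∃ y : ℕ → Fin 3 → ℤ, IsApproxSequence p ξ lam y := by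
  obtain ⟨N, hN⟩ := h.eventually_det_ne_zero (by linarith)
  obtain ⟨ι, hι, hP, hgap⟩ := exists_enumeration
    (P := fun n => N ≤ n ∧ (Matrix.of ![x n, x (n + 1), x (n + 2)]).det ≠ 0) fun M => by
      obtain ⟨n, hn, hdet⟩ := h.exists_det_three_ne_zero (by linarith) hξ (max M N)
      exact ⟨n, (le_max_left _ _).trans hn, (le_max_right _ _).trans hn, hdet⟩
  have hlt : ∀ k, ι k < ι (k + 1) := fun k => hι (Nat.lt_succ_self k)
  -- Between consecutive selected indices the plane of successive minimal points does not change.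
  have hplane : ∀ k z, (Matrix.of ![x (ι k + 1), x (ι k + 2), z]).det = 0 ↔
      (Matrix.of ![x (ι (k + 1)), x (ι (k + 1) + 1), z]).det = 0 := by
    intro k z
    refine h.plane_eq (hlt k) (fun l h1 h2 => ?_) z
    by_contra h3
    exact hgap k l h1 h2 ⟨(hP k).1.trans (by omega), h3⟩
  have hmeet : ∀ k, (Matrix.of ![x (ι k + 1), x (ι k + 2), x (ι (k + 1) + 1)]).det = 0 :=
    fun k => (hplane k _).2 (det_self_right _ _)
  have hspan : ∀ k, (Matrix.of ![x (ι k + 1), x (ι k + 2), x (ι (k + 1) + 2)]).det ≠ 0 :=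
    fun k h0 => (hP (k + 1)).2 ((hplane k _).1 h0)
  have hdet2 : ∀ k, (symMat (x (ι k + 1))).det ≠ 0 :=
    fun k => hN _ ((hP k).1.trans (Nat.le_succ _))
  have hdet3 : ∀ k, (Matrix.of ![x (ι k + 1), x (ι (k + 1) + 1), x (ι (k + 2) + 1)]).det ≠ 0 := by
    intro k
    have := hlt k
    have : ι (k + 1) < ι (k + 2) := hlt (k + 1)
    exact det_three_ne_zero_of_planes (h.cross_ne_zero (by omega)) (h.cross_ne_zero (by omega))
      (h.cross_ne_zero (by omega)) (h.cross_ne_zero (by omega)) (hmeet k) (hmeet (k + 1)) (hspan k)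
  set B := max 1 ‖ξ‖
  have hB : 1 ≤ B := le_max_left _ _
  have hξB : ‖ξ‖ ≤ B := le_max_right _ _
  have hmono (m n : ℕ) (hmn : m ≤ n) : ‖x m‖ ≤ ‖x n‖ := h.monotone hmn
  have hanti (m n : ℕ) (hmn : m ≤ n) : projDist p ξ (x n) ≤ projDist p ξ (x m) :=
    h.strictAnti.antitone hmn
  have hX (n : ℕ) : 0 < ‖x n‖ := one_pos.trans_le (h.one_le_norm n)
  have hD (n : ℕ) : 0 < projDist p ξ (x n) := projDist_pos hξ (h.primitive n).ne_zero
  have hL (n : ℕ) : 0 < padicL p ξ (x n) := pos_of_mul_pos_right (hD n) (norm_nonneg _)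
  have hlogD (n : ℕ) : log (projDist p ξ (x n)) = log ‖x n‖ + log (padicL p ξ (x n)) :=
    log_mul (hX n).ne' (hL n).ne'
  have hupper (n : ℕ) : log (projDist p ξ (x n)) ≤ log c₀ - (lam - 1) * log ‖x (n + 1)‖ := by
    linarith [log_le_of_le_mul_rpow (hD n) (hX _) hc₀ (h.upper n)]
  have hdet2_upper (n : ℕ) := absProd_det_two_le hB hξB (x n)
  have hdet3_upper (l m n : ℕ) (hlm : l ≤ m) (hmn : m ≤ n) :=
    absProd_det_three_le (h.primitive l).ne_zero (hmono l m hlm) (hmono m n hmn)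
      (hanti l m hlm) (hanti m n hmn)
  set c := |log c₀| + log (2 * B) + log 6 + log (8 * B ^ 4) with hc
  have hB4 : 1 ≤ B ^ 4 := one_le_pow₀ hB
  have p1 : 0 ≤ log (2 * B) := log_nonneg (by linarith)
  have p2 : 0 ≤ log 6 := log_nonneg (by norm_num)
  have p3 : 0 ≤ log (8 * B ^ 4) := log_nonneg (by linarith)
  have p4 := abs_nonneg (log c₀)
  have p5 := le_abs_self (log c₀)
  obtain ⟨C, hC, hlow, hupp, hdist⟩ := growth_bounds (a := fun k => log ‖x (ι k + 1)‖)
    (a' := fun k => log ‖x (ι k + 2)‖) (d := fun k => log (projDist p ξ (x (ι k + 1))))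
    (μ := lam - 1) (c := c) (by linarith) (by linarith)
    (fun k => by
      linarith [hupper (ι k + 1)])
    (fun k => by
      have e1 := log_nonneg ((one_le_absProd p (hP k).2).trans
        (hdet3_upper _ _ _ (Nat.le_succ _) (Nat.le_succ _)))
      rw [log_mul (by norm_num) (by have := hX (ι k + 2); have := hD (ι k); have := hD (ι k + 1); positivity),
        log_mul (mul_pos (hX _) (hD _)).ne' (hD _).ne', log_mul (hX _).ne' (hD _).ne'] at e1
      linarith [hupper (ι k), hupper (ι k + 1)])
    (fun k => by
      have e1 := log_nonneg ((one_le_absProd p (hdet2 k)).trans (hdet2_upper _))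
      rw [log_mul (by positivity) (mul_pos (hX _) (hD _)).ne', log_mul (hX _).ne' (hD _).ne'] at e1
      linarith)
    (fun k => log_le_log (hX _) (hmono _ _ (by have := hlt k; omega)))
    (fun k => by
      have e1 := log_le_log (hX _) (norm_le_of_planes_meet hB hξB (h.primitive _)
        (hmono _ _ (Nat.le_succ _)) (hmono _ _ (Nat.le_succ _)) (hanti _ _ (Nat.le_succ _))
        (hanti _ _ (Nat.le_succ _)) (hmeet k) (hspan k))
      rw [log_mul (by positivity) (mul_pos (mul_pos (hX _) (hD _)) (mul_pos (hX _) (hD _))).ne',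
        log_mul (mul_pos (hX _) (hD _)).ne' (mul_pos (hX _) (hD _)).ne',
        log_mul (hX _).ne' (hD _).ne', log_mul (hX _).ne' (hD _).ne'] at e1
      linarith)
  have hθ : (lam - 1) / (1 - (lam - 1)) = thetaOf lam := by
    rw [thetaOf]; congr 1; ring
  rw [hθ] at hlow hupp hdist
  set θ := thetaOf lam with hθdef
  have hθ1 : 1 < θ := by
    rw [hθdef, thetaOf, lt_div_iff₀ (by linarith)]; linarith
  set δ := θ ^ 2 / (θ + 1) with hδ
  have hδ0 : 0 ≤ δ := by positivity
  have hδθ : δ * (1 + θ) = θ ^ 2 := by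
    rw [hδ, add_comm 1 θ]; exact div_mul_cancel₀ _ (by linarith)
  set σ := 1 / (θ - 1) with hσ
  have hσ0 : 0 ≤ σ := by
    rw [hσ]; exact div_nonneg zero_le_one (by linarith)
  have hσ2 : 1 / (θ - 1) ^ 2 = σ ^ 2 := by rw [hσ, div_pow, one_pow]
  have hpos : ∀ {a : ℤ}, a ≠ 0 → 0 < absProd p a := fun ha => one_pos.trans_le (one_le_absProd p ha)
  refine ⟨fun k => x (ι k + 1), fun k _ => h.primitive _, fun R => ?_, ⟨exp C, exp_pos C, fun k _ => ?_⟩,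
    ⟨exp C, exp_pos C, fun k _ => ?_⟩, ⟨exp c, exp_pos c, fun k _ => ?_⟩, ⟨exp C, exp_pos C, fun k _ => ?_⟩,
    fun k _ => one_le_absProd p (hdet2 k), ⟨exp (c + C), exp_pos _, fun k _ => ?_⟩,
    fun k _ => one_le_absProd p (hdet3 k),
    ⟨exp (c + (C + σ * C) + 2 * C + δ * C), exp_pos _, fun k _ => ?_⟩⟩
  · obtain ⟨n, hn⟩ := h.eventually_lt_norm R
    exact ⟨n + 1, by omega, hn _ (by have := hι.id_le (n + 1); simp at this; omega)⟩
  · have := hlow k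
    rw [rpow_def_of_pos (hX _), ← exp_log (hX (ι (k + 1) + 1)), ← exp_add, exp_le_exp,
      ← hθdef]
    linarith
  · exact le_exp_mul_rpow_of_log_le (hX _) (hX _) (hupp k)
  · have e1 := log_nonneg ((one_le_absProd p (hdet2 k)).trans (hdet2_upper _))
    rw [log_mul (by positivity) (mul_pos (hX _) (hD _)).ne', log_mul (hX _).ne' (hD _).ne',
      hlogD] at e1
    rw [rpow_def_of_pos (hX _), ← exp_log (hL (ι k + 1)), ← exp_add, exp_le_exp]
    linarith
  · refine le_exp_mul_rpow_of_log_le (hL _) (hX _) ?_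
    have := hdist k
    rw [hlogD] at this
    linarith
  · refine le_exp_mul_rpow_of_log_le (hpos (hdet2 k)) (hX _) ?_
    have e1 := log_le_log (hpos (hdet2 k)) (hdet2_upper _)
    rw [log_mul (by positivity) (mul_pos (hX _) (hD _)).ne', log_mul (hX _).ne' (hD _).ne'] at e1
    linarith [hdist k]
  -- The determinant is ≪ Y_{k+2} D(y_k) D(y_{k+1}). Two growth steps give Y_{k+2} ≪ Y_k^(σ²), and
  -- the distances contribute Y_k^(-δ(1+θ)) = Y_k^(-θ²).
  · refine le_exp_mul_rpow_of_log_le (hpos (hdet3 k)) (hX _) ?_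
    have e1 := log_le_log (hpos (hdet3 k)) (hdet3_upper _ _ _ (by have := hlt k; omega)
      (by have : ι (k + 1) < ι (k + 2) := hlt (k + 1); omega))
    rw [log_mul (by norm_num) (mul_pos (mul_pos (hX _) (hD _)) (hD _)).ne',
      log_mul (mul_pos (hX _) (hD _)).ne' (hD _).ne', log_mul (hX _).ne' (hD _).ne'] at e1
    have e2 := hupp (k + 1)
    have e3 := mul_le_mul_of_nonneg_left (hupp k) hσ0
    have e4 := hdist k
    have e5 := hdist (k + 1)
    have e6 := mul_le_mul_of_nonneg_left (hlow k) hδ0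
    have e7 : δ * log ‖x (ι k + 1)‖ + δ * (θ * log ‖x (ι k + 1)‖)
        = θ ^ 2 * log ‖x (ι k + 1)‖ := by rw [← hδθ]; ring
    simp only [add_assoc, Nat.reduceAdd] at e1 e2 e3 e4 e5 e6 e7 ⊢
    rw [hσ2]
    linarith

theorem mainTheorem8 :
    ∃ lam0 : ℝ, (1.615358873 ≤ lam0 ∧ lam0 < 1.615358874) ∧
      ∀ (p : ℕ) [Fact p.Prime] (ξ : ℚ_[p]),
        2 < Module.rank ℚ (IntermediateField.adjoin ℚ {ξ}) →
        ∀ lam : ℝ, lam0 < lam → lam ≤ Real.goldenRatio → IsApproxExponent p 2 ξ lam →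
          (∃ y : ℕ → Fin 3 → ℤ, IsApproxSequence p ξ lam y) ∧
          ∀ y : ℕ → Fin 3 → ℤ, IsApproxSequence p ξ lam y →
            (∃ K : ℕ, 3 ≤ K ∧ ∀ k, K ≤ k →
              IsNonzeroRatMultiple (symMat (y (k + 1))) (bracket (y k) (y k) (y (k - 2)))) ∧
            ∃ M : Matrix (Fin 2) (Fin 2) ℤ, ¬ M.IsSymm ∧ M.det ≠ 0 ∧
              ∃ K : ℕ, 3 ≤ K ∧ ∀ k, K ≤ k →
                IsNonzeroRatMultiple (symMat (y (k + 1)))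
                  (symMat (y k) * (if Even k then M else M.transpose) * symMat (y (k - 1))) := by
  refine ⟨1.615358873, ⟨le_rfl, by norm_num⟩, fun p _ ξ hξ lam hlam0 hlam hexp => ?_⟩
  have hlam2 : lam < 2 := hlam.trans_lt Real.goldenRatio_lt_two
  -- At λ = 1.615358873 one has θ = 1.59982…, just above the threshold.
  have hθ : 1.5998 ≤ thetaOf lam := by
    rw [thetaOf, le_div_iff₀ (by linarith)]
    linarith
  refine ⟨?_, fun y hy => hy.bracket_and_matrix hθ⟩
  obtain ⟨c, hc, x, hx⟩ := hexp.exists_isMinimalSequence hξ (by linarith)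
  exact hx.exists_isApproxSequence hc hξ (by linarith) hlam2
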